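/- All graphs are finite and simple (no loops). For graphs $T,G$, a multi-homomorphism from $T$ to $G$ is a function $\phi$ assigning to each vertex of $T$ a non-empty set of vertices of $G$ such that every function $f\colon V(T)\to V(G)$ with $f(v)\in\phi(v)$ for all $v$ is a graph homomorphism. $\mathrm{Hom}(T,G)$ is the subcomplex of $\prod_{v\in V(T)}\Delta^{V(G)}$ (with $\Delta^{V(G)}$ the simplex with vertex set $V(G)$) consisting of the cells $\prod_v\phi(v)$ with $\phi$ a multi-homomorphism. An involutive homomorphism $\alpha\colon T\to T$ with $\{v,\alpha(v)\}\in E(T)$ for some $v$ induces a fixed point free involution on $\mathrm{Hom}(T,G)$ by precomposition. Let $K_2$ be the complete graph on $\{0,1\}$, with $\alpha(v)=1-v$, and, for $r\ge1$, let $C_{2r+1}$ be the cycle on $\{0,\dots,2r\}$, with $\alpha(v)=2r-v$; in this way $\mathrm{Hom}(K_2,G)$ and $\mathrm{Hom}(C_{2r+1},G)$ are free $\mathbb Z_2$-spaces. For a free $\mathbb Z_2$-space $X$ that is a CW-space, let $\bar f\colon X/\mathbb Z_2\to\mathbb{RP}^\infty$ be the map induced by a $\mathbb Z_2$-map $f\colon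 X\to S^\infty$ (which exists and is unique up to $\mathbb Z_2$-homotopy), and let $H^*(\mathbb{RP}^\infty;\mathbb Z_2)=\mathbb Z_2[\gamma]$ with $\gamma$ of degree $1$. The cohomological index is $$\operatorname{hind}X=\max\{k\ge 0 : \bar f^*(\gamma^k)\neq0 \text{ in } H^k(X/\mathbb Z_2;\mathbb Z_2)\},$$ with $\operatorname{hind}\emptyset=-1$ (and $\operatorname{hind}X=\infty$ if all $k$ occur). **Statement.** Let $G$ be a graph with at least one edge. Then for every $r\ge1$ $$\operatorname{hind}\mathrm{Hom}(C_{2r+1},G)+1\le\operatorname{hind}\mathrm{Hom}(K_2,G),$$ and $$\operatorname{hind}\mathrm{Hom}(C_{2r+1},G)\le\chi(G)-3,$$ where $\chi(G)$ is the chromatic number of $G$. -/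

import Mathlib

open scoped ENNReal

universe u v w

/-! ### Singular cohomology with coefficients in the field with two elements -/

namespace SingularZ2

/-- The singular `n`-simplices of `X`. -/
abbrev Simplex (n : ℕ) (X : Type u) [TopologicalSpace X] : Type u :=
  C(stdSimplex ℝ (Fin (n + 1)), X)

/-- The affine map of standard simplices given by a map of vertices. -/
noncomputable def affine {m n : ℕ} (a : Fin (m + 1) → Fin (n + 1)) :
    C(stdSimplex ℝ (Fin (m + 1)), stdSimplex ℝ (Fin (n + 1))) :=
  ⟨stdSimplex.map a, stdSimplex.continuous_map a⟩

/-- The `i`-th face of a singular simplex (the one opposite to the vertex `i`). -/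
noncomputable def face {X : Type u} [TopologicalSpace X] {n : ℕ} (i : Fin (n + 2))
    (σ : Simplex (n + 1) X) : Simplex n X :=
  σ.comp (affine i.succAbove)

/-- The one-dimensional face of a singular simplex spanned by the vertices `a` and `b`. -/
noncomputable def edge {X : Type u} [TopologicalSpace X] {n : ℕ} (a b : Fin (n + 1))
    (σ : Simplex n X) : Simplex 1 X :=
  σ.comp (affine ![a, b])

/-- Singular `n`-cochains with coefficients in `ZMod 2`. -/
abbrev Cochain (n : ℕ) (X : Type u) [TopologicalSpace X] : Type u :=
  Simplex n X → ZMod 2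

/-- The coboundary operator. The signs `(-1)^i` are `1` in `ZMod 2`. -/
noncomputable def coboundary (n : ℕ) (X : Type u) [TopologicalSpace X] :
    Cochain n X →ₗ[ZMod 2] Cochain (n + 1) X where
  toFun φ σ := ∑ i : Fin (n + 2), φ (face i σ)
  map_add' φ ψ := by
    funext σ
    simp [Finset.sum_add_distrib]
  map_smul' a φ := by
    funext σ
    simp [Finset.mul_sum]

/-- The cocycles of degree `n`. -/
noncomputable def cocycles (n : ℕ) (X : Type u) [TopologicalSpace X] :
    Submodule (ZMod 2) (Cochain n X) :=
  LinearMap.ker (coboundary n X)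

/-- The coboundaries of degree `n`; in degree `0` only the zero cochain is one. -/
noncomputable def coboundaries (n : ℕ) (X : Type u) [TopologicalSpace X] :
    Submodule (ZMod 2) (Cochain n X) :=
  match n with
  | 0 => ⊥
  | m + 1 => LinearMap.range (coboundary m X)

/-- The singular cohomology group `Hⁿ(X; ℤ/2)`, cocycles modulo coboundaries. -/
abbrev Cohomology (n : ℕ) (X : Type u) [TopologicalSpace X] : Type u :=
  cocycles n X ⧸ (coboundaries n X).submoduleOf (cocycles n X)

/-- The cohomology class of a cocycle. -/
noncomputable def cls {n : ℕ} {X : Type u} [TopologicalSpace X] (c : cocycles n X) :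
    Cohomology n X :=
  Submodule.Quotient.mk c

/-- The map on cochains induced by a continuous map. -/
def cochainPullback (n : ℕ) {X : Type u} {Y : Type v} [TopologicalSpace X] [TopologicalSpace Y]
    (f : C(X, Y)) : Cochain n Y →ₗ[ZMod 2] Cochain n X where
  toFun φ σ := φ (f.comp σ)
  map_add' _ _ := rfl
  map_smul' _ _ := rfl

theorem coboundary_cochainPullback (n : ℕ) {X : Type u} {Y : Type v} [TopologicalSpace X]
    [TopologicalSpace Y] (f : C(X, Y)) (φ : Cochain n Y) :
    coboundary n X (cochainPullback n f φ) = cochainPullback (n + 1) f (coboundary n Y φ) :=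
  rfl

/-- The map on cocycles induced by a continuous map. -/
noncomputable def cocyclesPullback (n : ℕ) {X : Type u} {Y : Type v} [TopologicalSpace X]
    [TopologicalSpace Y] (f : C(X, Y)) : cocycles n Y →ₗ[ZMod 2] cocycles n X :=
  (cochainPullback n f).restrict (by
    intro φ hφ
    have h : coboundary n Y φ = 0 := hφ
    change coboundary n X (cochainPullback n f φ) = 0
    rw [coboundary_cochainPullback, h, map_zero])

/-- The map `f^* : Hⁿ(Y; ℤ/2) → Hⁿ(X; ℤ/2)` induced by a continuous map `f : X → Y`. -/
noncomputable def pullback (n : ℕ) {X : Type u} {Y : Type v} [TopologicalSpace X]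
    [TopologicalSpace Y] (f : C(X, Y)) : Cohomology n Y →ₗ[ZMod 2] Cohomology n X :=
  Submodule.mapQ _ _ (cocyclesPullback n f) (by
    rintro ⟨φ, hφ⟩ h
    change φ ∈ coboundaries n Y at h
    change cochainPullback n f φ ∈ coboundaries n X
    cases n with
    | zero =>
      have h0 : φ = 0 := h
      rw [h0, map_zero]
      exact Submodule.zero_mem _
    | succ m =>
      obtain ⟨ψ, rfl⟩ := h
      exact ⟨cochainPullback m f ψ, coboundary_cochainPullback m f ψ⟩)

/-- The `k`-fold cup power of a `1`-cochain: by the Alexander-Whitney formula its value on `σ`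
is the product of the values of `c` on the consecutive edges of `σ`. For `k = 0` this is the
constant cochain `1`, the unit. -/
noncomputable def cupPowCochain {X : Type u} [TopologicalSpace X] (c : Cochain 1 X) (k : ℕ) :
    Cochain k X :=
  fun σ => ∏ i : Fin k, c (edge i.castSucc i.succ σ)

theorem sum_prod_skip (k : ℕ) (h : Fin (k + 2) → ZMod 2) :
    ∑ j : Fin (k + 2), ∏ i : Fin k,
      (h (j.succAbove i.castSucc) + h (j.succAbove i.succ)) = 0 := by
  induction k with
  | zero => simp; decide
  | succ k ih =>
    have e := ih (fun i => h i.succ)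
    rw [Fin.sum_univ_succ] at e
    rw [Fin.sum_univ_succ, Fin.sum_univ_succ]
    simp only [Fin.prod_univ_succ, Fin.castSucc_zero, Fin.succ_succAbove_zero,
      Fin.succ_succAbove_succ, Fin.zero_succAbove, Fin.castSucc_succ,
      Fin.succ_zero_eq_one] at e ⊢
    rw [← Finset.mul_sum]
    have a0 : (1 : Fin (k + 3)).succAbove 0 = 0 := Fin.one_succAbove_zero
    have a1 : ∀ i : Fin (k + 1), (1 : Fin (k + 3)).succAbove i.succ = i.succ.succ :=
      fun i => Fin.one_succAbove_succ i
    have a2 : (1 : Fin (k + 3)).succAbove 1 = Fin.succ 1 := a1 0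
    simp only [a0, a1, a2]
    have two : (2 : ZMod 2) = 0 := by decide
    linear_combination (h 0 + h 1) * e +
      h (Fin.succ 1) * (∏ i : Fin k, (h i.castSucc.succ.succ + h i.succ.succ.succ)) * two

theorem affine_comp_affine {l m n : ℕ} (a : Fin (m + 1) → Fin (n + 1))
    (b : Fin (l + 1) → Fin (m + 1)) : (affine a).comp (affine b) = affine (a ∘ b) := by
  ext1 x
  exact stdSimplex.map_comp_apply b a x

theorem edge_face {X : Type u} [TopologicalSpace X] {n : ℕ} (j : Fin (n + 2)) (a b : Fin (n + 1))
    (σ : Simplex (n + 1) X) : edge a b (face j σ) = edge (j.succAbove a) (j.succAbove b) σ := by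
  unfold edge face
  rw [ContinuousMap.comp_assoc, affine_comp_affine]
  congr 2
  funext i
  fin_cases i <;> rfl

theorem cocycle_edge {X : Type u} [TopologicalSpace X] {c : Cochain 1 X} (hc : c ∈ cocycles 1 X)
    {n : ℕ} (σ : Simplex n X) (p q r : Fin (n + 1)) :
    c (edge q r σ) = c (edge p q σ) + c (edge p r σ) := by
  have h : coboundary 1 X c = 0 := hc
  have h1 := congrFun h (σ.comp (affine ![p, q, r]))
  have key : ∀ i : Fin 3, face i (σ.comp (affine ![p, q, r])) =
      σ.comp (affine (![p, q, r] ∘ i.succAbove)) := fun i => by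
    unfold face
    rw [ContinuousMap.comp_assoc, affine_comp_affine]
  have e0 : (![p, q, r] ∘ (0 : Fin 3).succAbove) = ![q, r] := by
    funext i; fin_cases i <;> rfl
  have e1 : (![p, q, r] ∘ (1 : Fin 3).succAbove) = ![p, r] := by
    funext i; fin_cases i <;> rfl
  have e2 : (![p, q, r] ∘ (2 : Fin 3).succAbove) = ![p, q] := by
    funext i; fin_cases i <;> rfl
  change ∑ i : Fin 3, c (face i (σ.comp (affine ![p, q, r]))) = 0 at h1
  rw [Fin.sum_univ_three, key, key, key, e0, e1, e2] at h1
  change c (edge q r σ) + c (edge p r σ) + c (edge p q σ) = 0 at h1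
  generalize c (edge q r σ) = x at *
  generalize c (edge p r σ) = y at *
  generalize c (edge p q σ) = z at *
  revert x y z
  decide

theorem cupPowCochain_mem {X : Type u} [TopologicalSpace X] {c : Cochain 1 X}
    (hc : c ∈ cocycles 1 X) (k : ℕ) : cupPowCochain c k ∈ cocycles k X := by
  change coboundary k X (cupPowCochain c k) = 0
  funext σ
  change ∑ j : Fin (k + 2), ∏ i : Fin k, c (edge i.castSucc i.succ (face j σ)) = 0
  simp only [edge_face]
  rw [Finset.sum_congr rfl fun j _ => Finset.prod_congr rfl fun i _ =>
    cocycle_edge hc σ 0 (j.succAbove i.castSucc) (j.succAbove i.succ)]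
  exact sum_prod_skip k fun i => c (edge 0 i σ)

/-- The cup power `[c]^k` in `H^k(X; ℤ/2)` of the class of a `1`-cocycle `c`. -/
noncomputable def cupPow {X : Type u} [TopologicalSpace X] (c : cocycles 1 X) (k : ℕ) :
    Cohomology k X :=
  cls ⟨cupPowCochain c.1 k, cupPowCochain_mem c.2 k⟩

end SingularZ2

/-! ### Free `ℤ/2`-spaces and the cohomological index -/

/-- A topological space with a fixed point free involution. -/
structure FreeZ2Space : Type (u + 1) where
  carrier : Type u
  [top : TopologicalSpace carrier]
  τ : C(carrier, carrier)
  involutive : ∀ x, τ (τ x) = x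
  free : ∀ x, τ x ≠ x

namespace FreeZ2Space

instance : CoeSort FreeZ2Space.{u} (Type u) := ⟨carrier⟩

instance (X : FreeZ2Space.{u}) : TopologicalSpace X := X.top

/-- The orbit space `X / ℤ₂`, with the quotient topology. -/
abbrev Orbits (X : FreeZ2Space.{u}) : Type u :=
  Quot fun x y : X => y = X.τ x

/-- A `ℤ/2`-map: a continuous map that commutes with the involutions. -/
structure EquivariantMap (X : FreeZ2Space.{u}) (Y : FreeZ2Space.{v}) where
  toMap : C(X, Y)
  equivariant : ∀ x, toMap (X.τ x) = Y.τ (toMap x)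

/-- The map `X / ℤ₂ → Y / ℤ₂` induced by a `ℤ/2`-map. -/
def EquivariantMap.onOrbits {X : FreeZ2Space.{u}} {Y : FreeZ2Space.{v}}
    (f : EquivariantMap X Y) : C(X.Orbits, Y.Orbits) where
  toFun := Quot.map f.toMap (by
    rintro x y rfl
    exact f.equivariant x)
  continuous_toFun := continuous_quot_lift _ (continuous_quot_mk.comp f.toMap.continuous)

end FreeZ2Space

/-- The sphere `Sⁿ`, as the unit sphere of the space spanned by the first `n + 1` coordinates of
`ℝ^ℕ`. -/
def finiteSphere (n : ℕ) : Set (ℕ → ℝ) :=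
  {x | (∀ i, n < i → x i = 0) ∧ ∑ i ∈ Finset.range (n + 1), x i ^ 2 = 1}

/-- The points of `S^∞`, the union of the spheres `Sⁿ`. -/
def InfiniteSphere : Type :=
  {x : ℕ → ℝ // ∃ n, x ∈ finiteSphere n}

namespace InfiniteSphere

/-- The inclusion of `Sⁿ` into `S^∞`. -/
def incl (n : ℕ) (x : finiteSphere n) : InfiniteSphere :=
  ⟨x.1, n, x.2⟩

/-- The topology of `S^∞` as the colimit of the spheres `Sⁿ`. -/
instance : TopologicalSpace InfiniteSphere :=
  ⨆ n, TopologicalSpace.coinduced (incl n) inferInstance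

theorem neg_mem {n : ℕ} {x : ℕ → ℝ} (h : x ∈ finiteSphere n) : -x ∈ finiteSphere n :=
  ⟨fun i hi => by simp [h.1 i hi], by simpa using h.2⟩

/-- The antipodal map of `S^∞`. -/
def antipode (x : InfiniteSphere) : InfiniteSphere :=
  ⟨-x.1, x.2.imp fun _ h => neg_mem h⟩

theorem continuous_antipode : Continuous antipode := by
  refine continuous_iSup_dom.2 fun n => continuous_coinduced_dom.2 ?_
  have h1 : Continuous (incl n) := continuous_iSup_rng (i := n) continuous_coinduced_rng
  have h2 : Continuous fun x : finiteSphere n => (⟨-x.1, neg_mem x.2⟩ : finiteSphere n) :=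
    (continuous_neg.comp continuous_subtype_val).subtype_mk _
  exact h1.comp h2

end InfiniteSphere

/-- `S^∞` with the antipodal map. Its orbit space is `ℝP^∞`. -/
def sphereInfty : FreeZ2Space.{0} where
  carrier := InfiniteSphere
  τ := ⟨InfiniteSphere.antipode, InfiniteSphere.continuous_antipode⟩
  involutive x := Subtype.ext (neg_neg x.1)
  free x h := by
    obtain ⟨n, hn⟩ := x.2
    have h0 : ∀ i, x.1 i = 0 := fun i => by
      have : -x.1 i = x.1 i := congrFun (congrArg Subtype.val h) i
      linarith
    have h1 := hn.2
    simp [h0] at h1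

/-- The infinite-dimensional real projective space. -/
abbrev RPInfty : Type := sphereInfty.Orbits

/-- The cohomological index of a free `ℤ/2`-space: the largest `k` such that the map
`X / ℤ₂ → ℝP^∞` induced by a `ℤ/2`-map `f : X → S^∞` does not send `γ^k` to zero, where `γ` is
the generator of `H¹(ℝP^∞; ℤ/2) ≅ ℤ/2`. If there is no such `k` (that is, for `X = ∅`) the index
is `-1`, and it is `∞` if all `k` occur. -/
noncomputable def cohomologicalIndex (X : FreeZ2Space.{u}) : EReal :=
  sSup (insert (-1) {a : EReal | ∃ k : ℕ, a = (k : EReal) ∧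
    ∃ (f : X.EquivariantMap sphereInfty) (γ : SingularZ2.cocycles 1 RPInfty),
      SingularZ2.cls γ ≠ 0 ∧
        SingularZ2.pullback k f.onOrbits (SingularZ2.cupPow γ k) ≠ 0})

/-! ### Hom complexes of graphs -/

/-- A multi-homomorphism from `T` to `G`: a function from the vertices of `T` to the nonempty sets
of vertices of `G` all of whose selections are graph homomorphisms. -/
def IsMultiHom {V : Type v} {W : Type w} (T : SimpleGraph V) (G : SimpleGraph W)
    (φ : V → Set W) : Prop :=
  (∀ v, (φ v).Nonempty) ∧
    ∀ f : V → W, (∀ v, f v ∈ φ v) → ∀ u u', T.Adj u u' → G.Adj (f u) (f u')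

/-- The (underlying space of the) cell complex `Hom(T, G)`. A point of the product over `v ∈ V(T)`
of the simplices with vertex set `V(G)` lies in the relative interior of exactly one cell, the
product of the faces spanned by the supports of its components; it belongs to `Hom(T, G)` when
this cell is a multi-homomorphism. -/
def HomComplex {V : Type v} {W : Type w} [Fintype W] (T : SimpleGraph V) (G : SimpleGraph W) :
    Type (max v w) :=
  {x : V → stdSimplex ℝ W // IsMultiHom T G fun v => {a | x v a ≠ 0}}

instance {V : Type v} {W : Type w} [Fintype W] (T : SimpleGraph V) (G : SimpleGraph W) :
    TopologicalSpace (HomComplex T G) :=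
  inferInstanceAs (TopologicalSpace {x : V → stdSimplex ℝ W //
    IsMultiHom T G fun v => {a | x v a ≠ 0}})

theorem IsMultiHom.comp {V : Type v} {W : Type w} {T : SimpleGraph V} {G : SimpleGraph W}
    {φ : V → Set W} (h : IsMultiHom T G φ) (α : T →g T) (hα : ∀ v, α (α v) = v) :
    IsMultiHom T G fun v => φ (α v) :=
  ⟨fun v => h.1 (α v), fun f hf u u' huu' => by
    have := h.2 (fun v => f (α v)) (fun v => by simpa [hα] using hf (α v)) (α u) (α u')
      (α.map_rel huu')
    simpa [hα] using this⟩

/-- The space `Hom(T, G)` with the involution induced by an involution `α` of `T` that flips an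
edge. -/
def homZ2Space {V : Type v} {W : Type w} [Fintype W] (T : SimpleGraph V) (α : T →g T)
    (hα : ∀ v, α (α v) = v) (hflip : ∃ v, T.Adj v (α v)) (G : SimpleGraph W) :
    FreeZ2Space.{max v w} where
  carrier := HomComplex T G
  τ := ⟨fun x => ⟨fun v => x.1 (α v), x.2.comp α hα⟩,
    Continuous.subtype_mk (continuous_pi fun v =>
      (continuous_apply (α v)).comp (continuous_subtype_val (p := fun x : V → stdSimplex ℝ W =>
        IsMultiHom T G fun v => {a | x v a ≠ 0}))) _⟩
  involutive x := Subtype.ext (funext fun v => congrArg x.1 (hα v))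
  free x h := by
    obtain ⟨v, hv⟩ := hflip
    have hx : x.1 (α v) = x.1 v := congrFun (congrArg Subtype.val h) v
    choose g hg using x.2.1
    classical
    have hmem : ∀ u, Function.update g (α v) (g v) u ∈ {a | x.1 u a ≠ 0} := by
      intro u
      by_cases hu : u = α v
      · subst hu
        rw [Function.update_self, hx]
        exact hg v
      · rw [Function.update_of_ne hu]
        exact hg u
    have := x.2.2 _ hmem v (α v) hv
    rw [Function.update_self, Function.update_of_ne hv.ne] at this
    exact G.loopless.irrefl _ this

/-- The involution `v ↦ 1 - v` of the complete graph `K₂`. -/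
def swapK2 : (⊤ : SimpleGraph (Fin 2)) →g (⊤ : SimpleGraph (Fin 2)) where
  toFun := Fin.rev
  map_rel' h := fun e => h (Fin.rev_injective e)

/-- The involution `v ↦ n - v` of the cycle with vertices `0, …, n`. -/
def reflectCycle (n : ℕ) : SimpleGraph.cycleGraph (n + 1) →g SimpleGraph.cycleGraph (n + 1) where
  toFun := Fin.rev
  map_rel' {a b} h := by
    rw [SimpleGraph.cycleGraph_eq_circulantGraph, SimpleGraph.circulantGraph_adj] at h ⊢
    have e : ∀ a b : Fin (n + 1), Fin.rev a - Fin.rev b = b - a := fun a b => by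
      rw [← Fin.last_sub, ← Fin.last_sub]
      abel
    rw [e, e]
    exact ⟨fun h' => h.1 (Fin.rev_injective h'), h.2.symm⟩

/-- `Hom(K₂, G)` as a free `ℤ/2`-space. -/
def homK2 {W : Type w} [Fintype W] (G : SimpleGraph W) : FreeZ2Space.{w} :=
  homZ2Space ⊤ swapK2 Fin.rev_rev ⟨0, by decide⟩ G

theorem reflectCycle_flips (r : ℕ) (hr : 1 ≤ r) :
    ∃ v, (SimpleGraph.cycleGraph (2 * r + 1)).Adj v (reflectCycle (2 * r) v) := by
  refine ⟨0, ?_⟩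
  change (SimpleGraph.cycleGraph (2 * r + 1)).Adj 0 (Fin.rev 0)
  rw [SimpleGraph.cycleGraph_eq_circulantGraph, SimpleGraph.circulantGraph_adj, Fin.rev_zero]
  refine ⟨fun h => ?_, Or.inl ?_⟩
  · have := congrArg Fin.val h
    simp at this
    omega
  · change (0 : Fin (2 * r + 1)) - Fin.last (2 * r) = 1
    rw [sub_eq_iff_eq_add]
    exact ((add_comm _ _).trans (Fin.last_add_one _)).symm

/-- `Hom(C_{2r+1}, G)` as a free `ℤ/2`-space. -/
def homOddCycle {W : Type w} [Fintype W] (r : ℕ) (hr : 1 ≤ r) (G : SimpleGraph W) :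
    FreeZ2Space.{w} :=
  homZ2Space (SimpleGraph.cycleGraph (2 * r + 1)) (reflectCycle (2 * r)) Fin.rev_rev
    (reflectCycle_flips r hr) G

/-!
Write `w(X)` for the class in `H¹(X/ℤ₂; ℤ/2)` of the double covering `X → X/ℤ₂`, so that
`hind X` is the largest `k` with `w(X)^k ≠ 0`. The theorem rests on three facts.

**A cochain model of `w(X)^k`.** Choose a function `ε : X → ℤ/2`, not continuous, with
`ε(τx) = ε(x) + 1` (`FreeZ2Space.IsSign`). The cochain whose value on a singular simplex `σ` of
`X/ℤ₂` is `∏ᵢ (ε(vᵢ) + ε(vᵢ₊₁))`, the `vᵢ` being the vertices of a lift of `σ` to `X`, represents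
`w(X)^k` (`FreeZ2Space.wordCochain`). It is pulled back to another cochain of the same form by every
`ℤ/2`-map, and changing `ε`, even in each factor separately, changes it by a coboundary
(`FreeZ2Space.wordCochain_mem_of_mem`). As `S^∞` is contractible, every cocycle on `ℝP^∞` with a
nonzero class is literally of this form for `k = 1` (`FreeZ2Space.exists_isSign_of_cls_ne_zero`).

**Raising the index by one.** Suppose that a map `P : X → Y` with `P ∘ τ = P` is homotopic to a
`ℤ/2`-map `Q : X → Y`. Such a homotopy amounts to an equivariant map to `Y` from a bundle over
`X/ℤ₂` with fibre the circle, the circle being formed by the homotopy and its translate. Integration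
along the fibre, which on cochains is the prism operator followed by the transfer of `X → X/ℤ₂`,
sends `w(Y)^(k+1)` to `w(X)^k`; hence `w(Y)^(k+1) = 0` implies `w(X)^k = 0`
(`FreeZ2Space.wordCochain_mem_of_homotopy`). For `X = Hom(C_{2r+1}, G)` and `Y = Hom(K₂, G)` let
`Q x = (x₀, x_{2r})`. Replacing alternately the two components, along straight lines, moves `Q`
through the pairs of consecutive `xᵢ` to `(x_r, (x_{r-1} + x_{r+1}) / 2)`, up to the order of the
components, and this map is invariant under the reflection of the cycle (`exists_homotopy`).

**The upper bound.** If `G` has a colouring with `k + 1` colours, the functions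
`fᵢ x = ∑ (x₀(v) - x₁(v))`, summed over the vertices `v` of colour `i`, for `i < k`, are odd and
without common zero on `Hom(K₂, G)`. Take for the `i`-th factor of a representative of `w^k` a
function `ε` that agrees with the sign of `fᵢ` where `fᵢ ≠ 0`. This representative vanishes on all
simplices that lie in one of the open sets `fᵢ ≠ 0`, and a cocycle that vanishes on the small
simplices of an open cover is a coboundary (`SingularZ2.mem_coboundaries_of_small`), by barycentric
subdivision. Hence `w^k = 0` (`wordCochain_homK2_mem`), that is, `hind Hom(K₂, G) ≤ χ(G) - 2`.

All chain-level computations take place in the complex of functions of `(n + 1)`-tuples of elements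
of a set (`TupleCochain`), from which they are transported to singular cochains.
-/

/-! ### Cochains on tuples of elements of a set -/

namespace TupleCochain

/-- The `n`-cochains with coefficients in `ZMod 2` of the simplicial set of all tuples of elements
of `S`; degenerate tuples are not excluded. -/
abbrev _root_.TupleCochain (n : ℕ) (S : Type u) : Type u := (Fin (n + 1) → S) → ZMod 2

variable {S : Type u} {n : ℕ}

/-- The coboundary operator. -/
def d (φ : TupleCochain n S) : TupleCochain (n + 1) S :=
  fun v => ∑ i : Fin (n + 2), φ (v ∘ i.succAbove)

/-- The cochain `v ↦ φ (x, v)`, which is the transpose of the cone operator with apex `x`. -/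
def cone (x : S) (φ : TupleCochain (n + 1) S) : TupleCochain n S :=
  fun v => φ (Fin.cons x v)

theorem d_add (φ ψ : TupleCochain n S) : d (φ + ψ) = d φ + d ψ := by
  funext v; simp [d, Finset.sum_add_distrib]

theorem d_zero : d (0 : TupleCochain n S) = 0 := by
  funext v; simp [d]

theorem cone_add (x : S) (φ ψ : TupleCochain (n + 1) S) :
    cone x (φ + ψ) = cone x φ + cone x ψ := rfl

theorem add_self {ι : Type*} (φ : ι → ZMod 2) : φ + φ = 0 :=
  funext fun _ => CharTwo.add_self_eq_zero _

theorem cons_comp_succ_succAbove {m : ℕ} (x : S) (v : Fin (m + 1) → S) (i : Fin (m + 1)) :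
    (Fin.cons x v : Fin (m + 2) → S) ∘ i.succ.succAbove = Fin.cons x (v ∘ i.succAbove) := by
  funext j
  refine Fin.cases ?_ (fun j => ?_) j <;> simp

theorem cons_comp_zero_succAbove {m : ℕ} (x : S) (v : Fin m → S) :
    (Fin.cons x v : Fin (m + 1) → S) ∘ (0 : Fin (m + 1)).succAbove = v := by
  funext j; simp

/-- The boundary of the cone over `v` consists of `v` and of the cone over the boundary of `v`. -/
theorem d_cons (φ : TupleCochain (n + 1) S) (x : S) (v : Fin (n + 2) → S) :
    d φ (Fin.cons x v) = φ v + d (cone x φ) v := by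
  rw [d, Fin.sum_univ_succ, cons_comp_zero_succAbove]
  simp only [cons_comp_succ_succAbove]
  rfl

theorem cone_d (φ : TupleCochain (n + 1) S) (x : S) : cone x (d φ) = φ + d (cone x φ) :=
  funext fun v => d_cons φ x v

theorem d_cons_zero (φ : TupleCochain 0 S) (x : S) (v : Fin 1 → S) :
    d φ (Fin.cons x v) = φ v + φ (fun _ => x) := by
  rw [d, Fin.sum_univ_succ, cons_comp_zero_succAbove]
  simp only [cons_comp_succ_succAbove, Fin.sum_univ_succ, Finset.univ_eq_empty, Finset.sum_empty,
    add_zero]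
  congr 2
  funext j
  rw [Fin.fin_one_eq_zero j]
  rfl

/-- A constant cochain of even degree is a cocycle, its coboundary being a sum of an even number
of equal terms. -/
theorem d_const {m : ℕ} (a : ZMod 2) (v : Fin (2 * m + 2) → S) :
    d (fun _ : Fin (2 * m + 1) → S => a) v = 0 := by
  have : ((2 * m + 2 : ℕ) : ZMod 2) = 0 := by
    rw [ZMod.natCast_eq_zero_iff]; omega
  simp only [d, Finset.sum_const, Finset.card_univ, Fintype.card_fin, nsmul_eq_mul]
  rw [this, zero_mul]

theorem d_d (φ : TupleCochain n S) : d (d φ) = 0 := by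
  induction n with
  | zero =>
    funext v
    induction v using Fin.consCases with | _ x v
    have h : cone x (d φ) = φ + fun _ => φ fun _ => x := funext fun w => d_cons_zero φ x w
    rw [d_cons, h, d_add, Pi.add_apply, d_const (m := 0), add_zero]
    exact CharTwo.add_self_eq_zero _
  | succ n ih =>
    funext v
    induction v using Fin.consCases with | _ x v
    rw [d_cons, cone_d, d_add, ih, add_zero]
    exact CharTwo.add_self_eq_zero _

/-- The cochain induced by a map of sets. -/
def comap {S' : Type v} (g : S → S') (φ : TupleCochain n S') : TupleCochain n S :=
  fun v => φ (g ∘ v)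

theorem d_comap {S' : Type v} (g : S → S') (φ : TupleCochain n S') :
    d (comap g φ) = comap g (d φ) := rfl

theorem comp_cons {S' : Type v} (g : S → S') {m : ℕ} (x : S) (v : Fin m → S) :
    g ∘ (Fin.cons x v : Fin (m + 1) → S) = Fin.cons (g x) (g ∘ v) := by
  funext j
  refine Fin.cases ?_ (fun j => ?_) j <;> simp

theorem cone_comap {S' : Type v} (g : S → S') (x : S) (φ : TupleCochain (n + 1) S') :
    cone x (comap g φ) = comap g (cone (g x) φ) :=
  funext fun v => by simp only [cone, comap, comp_cons]

/-! ### Cup products of coboundaries of functions -/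

/-- The cup product `h ∪ φ` of a `0`-cochain `h` and `φ`. -/
def cupZero (h : S → ZMod 2) (φ : TupleCochain n S) : TupleCochain n S :=
  fun v => h (v 0) * φ v

/-- The cup product `δh ∪ φ` of the coboundary of a `0`-cochain `h` and `φ`. -/
def dcup (h : S → ZMod 2) (φ : TupleCochain n S) : TupleCochain (n + 1) S :=
  fun v => (h (v 0) + h (v 1)) * φ (Fin.tail v)

theorem dcup_cons (h : S → ZMod 2) (φ : TupleCochain n S) (x : S) (v : Fin (n + 1) → S) :
    dcup h φ (Fin.cons x v) = (h x + h (v 0)) * φ v := by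
  simp only [dcup, Fin.cons_zero, Fin.tail_cons]
  rw [← Fin.succ_zero_eq_one, Fin.cons_succ]

theorem dcup_add (h : S → ZMod 2) (φ ψ : TupleCochain n S) :
    dcup h (φ + ψ) = dcup h φ + dcup h ψ := by
  funext v; simp only [dcup, Pi.add_apply]; ring

theorem add_dcup (h k : S → ZMod 2) (φ : TupleCochain n S) :
    dcup (h + k) φ = dcup h φ + dcup k φ := by
  funext v; simp only [dcup, Pi.add_apply]; ring

theorem dcup_zero (h : S → ZMod 2) : dcup h (0 : TupleCochain n S) = 0 := by
  funext v; simp [dcup]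

theorem d_cupZero (h : S → ZMod 2) (φ : TupleCochain n S) :
    d (cupZero h φ) = dcup h φ + cupZero h (d φ) := by
  funext v
  induction v using Fin.consCases with | _ x v
  rw [Pi.add_apply, dcup_cons]
  simp only [d, cupZero, Fin.cons_zero]
  rw [Fin.sum_univ_succ, Fin.sum_univ_succ (f := fun i => φ (Fin.cons x v ∘ i.succAbove)),
    cons_comp_zero_succAbove]
  simp only [cons_comp_succ_succAbove, Fin.cons_zero]
  rw [← Finset.mul_sum]
  linear_combination (-(h x * φ v)) * CharTwo.two_eq_zero (R := ZMod 2)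

theorem dcup_eq (h : S → ZMod 2) (φ : TupleCochain n S) :
    dcup h φ = d (cupZero h φ) + cupZero h (d φ) := by
  rw [d_cupZero, add_assoc, add_self, add_zero]

theorem d_dcup (h : S → ZMod 2) (φ : TupleCochain n S) : d (dcup h φ) = dcup h (d φ) := by
  rw [dcup_eq, d_add, d_d, zero_add, d_cupZero, d_d]
  funext v; simp [cupZero]

/-- The cup product `δa₀ ∪ ⋯ ∪ δaₙ₋₁`. -/
def word (a : ℕ → S → ZMod 2) : (n : ℕ) → TupleCochain n S
  | 0 => fun _ => 1
  | n + 1 => dcup (a 0) (word (fun i => a (i + 1)) n)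

theorem word_eq_prod (a : ℕ → S → ZMod 2) (n : ℕ) (v : Fin (n + 1) → S) :
    word a n v = ∏ i : Fin n, (a i (v i.castSucc) + a i (v i.succ)) := by
  induction n generalizing a with
  | zero => simp [word]
  | succ n ih =>
    rw [word, dcup, ih, Fin.prod_univ_succ]
    rfl

theorem d_word (a : ℕ → S → ZMod 2) (n : ℕ) : d (word a n) = 0 := by
  induction n generalizing a with
  | zero => exact funext fun v => d_const (m := 0) 1 v
  | succ n ih => rw [word, d_dcup, ih, dcup_zero]

/-- A cochain whose coboundary is the difference of the cup products `δa₀ ∪ ⋯ ∪ δaₙ` and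
`δb₀ ∪ ⋯ ∪ δbₙ`, obtained by replacing the factors one at a time. It depends on `aᵢ + bᵢ` and on the
coboundaries of `aᵢ` and `bᵢ` only. -/
def wordHomotopy (a b : ℕ → S → ZMod 2) : (n : ℕ) → TupleCochain n S
  | 0 => fun v => a 0 (v 0) + b 0 (v 0)
  | n + 1 => dcup (a 0) (wordHomotopy (fun i => a (i + 1)) (fun i => b (i + 1)) n) +
      cupZero (a 0 + b 0) (word (fun i => b (i + 1)) (n + 1))

theorem d_wordHomotopy (a b : ℕ → S → ZMod 2) (n : ℕ) :
    d (wordHomotopy a b n) = word a (n + 1) + word b (n + 1) := by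
  induction n generalizing a b with
  | zero =>
    have h : wordHomotopy a b 0 = cupZero (a 0 + b 0) (word b 0) := by
      funext v; simp [wordHomotopy, cupZero, word]
    rw [h, d_cupZero, d_word]
    rw [word, word, add_dcup]
    funext v; simp [word, cupZero]
  | succ n ih =>
    rw [wordHomotopy, d_add, d_dcup, ih, d_cupZero, d_word, add_dcup, dcup_add]
    change _ = dcup (a 0) (word (fun i => a (i + 1)) (n + 1)) +
      dcup (b 0) (word (fun i => b (i + 1)) (n + 1))
    have : cupZero (a 0 + b 0) (0 : TupleCochain (n + 1 + 1) S) = 0 := by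
      funext v; simp [cupZero]
    rw [this, add_zero]
    rw [show ∀ x y z : TupleCochain (n + 2) S, x + y + (y + z) = x + (y + y) + z from
      fun x y z => by abel, add_self, add_zero]

/-! ### The prism operator -/

/-- The transpose of the prism operator, which sends a tuple `v` to the sum of the tuples
`(p v₀, …, p vᵢ, q vᵢ, …, q vₙ)`. -/
def prism {S' : Type v} (p q : S → S') : {n : ℕ} → TupleCochain (n + 1) S' → TupleCochain n S
  | 0, φ => fun v => φ ![p (v 0), q (v 0)]
  | _ + 1, φ => fun v => φ (Fin.cons (p (v 0)) (q ∘ v)) +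
      prism p q (cone (p (v 0)) φ) (Fin.tail v)

variable {S' : Type v} (p q : S → S')

theorem prism_cons (φ : TupleCochain (n + 2) S') (x : S) (v : Fin (n + 1) → S) :
    prism p q φ (Fin.cons x v) =
      φ (Fin.cons (p x) (Fin.cons (q x) (q ∘ v))) + prism p q (cone (p x) φ) v := by
  simp only [prism, Fin.cons_zero, Fin.tail_cons, comp_cons]

theorem prism_add (φ ψ : TupleCochain (n + 1) S') :
    prism p q (φ + ψ) = prism p q φ + prism p q ψ := by
  induction n with
  | zero => rfl
  | succ n ih =>
    funext v
    simp only [prism, Pi.add_apply, cone_add, ih]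
    ring

theorem prism_zero : prism p q (0 : TupleCochain (n + 1) S') = 0 := by
  have := prism_add p q (0 : TupleCochain (n + 1) S') 0
  rw [add_zero] at this
  simpa using this

theorem cone_prism (φ : TupleCochain (n + 2) S') (x : S) :
    cone x (prism p q φ) = comap q (cone (q x) (cone (p x) φ)) + prism p q (cone (p x) φ) :=
  funext fun v => prism_cons p q φ x v

theorem prism_d_zero (φ : TupleCochain 0 S') :
    prism p q (d φ) = comap p φ + comap q φ := by
  funext v
  change d φ (Fin.cons (p (v 0)) ![q (v 0)]) = _
  have h : v = fun _ => v 0 := funext fun i => by rw [Fin.fin_one_eq_zero i]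
  rw [d_cons_zero, add_comm]
  simp only [comap, Pi.add_apply]
  congr 2
  · rw [h]; rfl
  · funext i; rw [Fin.fin_one_eq_zero i]; rfl

/-- The prism operator is a chain homotopy between the maps induced by `p` and `q`. -/
theorem prism_d (φ : TupleCochain (n + 1) S') :
    prism p q (d φ) = d (prism p q φ) + comap p φ + comap q φ := by
  induction n with
  | zero =>
    funext v
    induction v using Fin.consCases with | _ x v
    have h : prism p q φ = fun v => φ ![p (v 0), q (v 0)] := rfl
    have hv : v = fun _ => v 0 := funext fun i => by rw [Fin.fin_one_eq_zero i]
    rw [prism_cons, d_cons, cone_d, prism_add, prism_d_zero, Pi.add_apply, Pi.add_apply,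
      Pi.add_apply, Pi.add_apply, d_cons_zero, d_cons_zero, ← comp_cons]
    simp only [cone, comap, comp_cons, h]
    have e1 : (Fin.cons (p x) (fun _ => q x) : Fin 2 → S') = ![p x, q x] := by
      funext i; fin_cases i <;> rfl
    rw [e1]
    linear_combination φ (Fin.cons (p x) (q ∘ v)) * CharTwo.two_eq_zero (R := ZMod 2)
  | succ n ih =>
    funext v
    induction v using Fin.consCases with | _ x v
    rw [prism_cons, d_cons, cone_d, prism_add, ih, d_cons]
    simp only [Pi.add_apply]
    rw [d_cons (prism p q φ), cone_prism, d_add, d_comap]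
    simp only [comap, comp_cons, Pi.add_apply]
    simp only [cone]
    linear_combination φ (Fin.cons (p x) (q ∘ v)) * CharTwo.two_eq_zero (R := ZMod 2)

/-- The sum of the cup products `(δa)^i ∪ (δb)^(n - i)` over `0 ≤ i ≤ n`. -/
def wordSum (a b : S → ZMod 2) : (n : ℕ) → TupleCochain n S
  | 0 => fun _ => 1
  | n + 1 => word (fun _ => b) (n + 1) + dcup a (wordSum a b n)

theorem d_wordSum (a b : S → ZMod 2) (n : ℕ) : d (wordSum a b n) = 0 := by
  induction n with
  | zero => exact funext fun v => d_const (m := 0) 1 v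
  | succ n ih => rw [wordSum, d_add, d_word, d_dcup, ih, dcup_zero, add_zero]

/-- All terms of the sum with `i > 0` are coboundaries. -/
theorem wordSum_succ (a b : S → ZMod 2) (n : ℕ) :
    wordSum a b (n + 1) = word (fun _ => b) (n + 1) + d (cupZero a (wordSum a b n)) := by
  rw [d_cupZero, d_wordSum, wordSum]
  congr 1
  funext v; simp [cupZero]

theorem prism_word_zero (c : S' → ZMod 2) (v : Fin 1 → S) :
    prism p q (word (fun _ => c) 1) v = c (p (v 0)) + c (q (v 0)) := by
  simp [prism, word, dcup]

theorem prism_const_mul (a : ZMod 2) (φ : TupleCochain (n + 1) S') :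
    prism p q (fun w => a * φ w) = fun w => a * prism p q φ w := by
  obtain rfl | rfl : a = 0 ∨ a = 1 := by revert a; decide
  · simp only [zero_mul]
    exact prism_zero p q
  · simp only [one_mul]

theorem prism_cupZero (h : S' → ZMod 2) (φ : TupleCochain (n + 1) S') :
    prism p q (cupZero h φ) = cupZero (h ∘ p) (prism p q φ) := by
  funext v
  cases n with
  | zero => rfl
  | succ n =>
    induction v using Fin.consCases with | _ x v
    rw [prism_cons]
    have e : cone (p x) (cupZero h φ) = fun w => h (p x) * cone (p x) φ w := rfl
    rw [e, prism_const_mul, cupZero, cupZero, prism_cons]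
    simp only [Fin.cons_zero, Function.comp_apply]
    ring

theorem prism_dcup (c : S' → ZMod 2) (φ : TupleCochain (n + 1) S') :
    prism p q (dcup c φ) =
      cupZero (c ∘ p + c ∘ q) (comap q φ) + dcup (c ∘ p) (prism p q φ) := by
  funext v
  induction v using Fin.consCases with | _ x v
  have e : cone (p x) (dcup c φ) = cupZero (fun y => c (p x) + c y) φ :=
    funext fun w => dcup_cons c φ _ _
  rw [prism_cons, dcup_cons, e, prism_cupZero, Pi.add_apply, dcup_cons]
  simp only [cupZero, comap, comp_cons, Fin.cons_zero, Function.comp_apply, Pi.add_apply]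

theorem comap_word (g : S → S') (a : ℕ → S' → ZMod 2) (n : ℕ) :
    comap g (word a n) = word (fun i => a i ∘ g) n := by
  funext v
  simp only [comap, word_eq_prod]
  rfl

/-- The two prism terms agree except in the factor at which the prism passes from `p` to `q` or from
`p'` to `q'`; these factors differ by `1`, so that their sum cancels the factor. -/
theorem prism_word_add (c : S' → ZMod 2) (p' q' : S → S')
    (hp : ∀ x, c (p' x) = c (p x)) (hq : ∀ x, c (q' x) = c (q x) + 1) (n : ℕ) :
    prism p q (word (fun _ => c) (n + 1)) + prism p' q' (word (fun _ => c) (n + 1)) =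
      wordSum (c ∘ p) (c ∘ q) n := by
  induction n with
  | zero =>
    funext v
    rw [Pi.add_apply, prism_word_zero, prism_word_zero, hp, hq, wordSum]
    linear_combination (c (p (v 0)) + c (q (v 0))) * CharTwo.two_eq_zero (R := ZMod 2)
  | succ n ih =>
    have hp' : c ∘ p' = c ∘ p := funext hp
    have hw : word (fun _ => c ∘ q') (n + 1) = word (fun _ => c ∘ q) (n + 1) := by
      funext v
      rw [word_eq_prod, word_eq_prod]
      refine Finset.prod_congr rfl fun i _ => ?_
      simp only [Function.comp_apply, hq]
      linear_combination CharTwo.two_eq_zero (R := ZMod 2)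
    rw [word, prism_dcup, prism_dcup, comap_word, comap_word, hw, wordSum, ← ih, dcup_add, hp']
    funext v
    simp only [Pi.add_apply, cupZero, Function.comp_apply, hq]
    linear_combination ((c (p (v 0)) + c (q (v 0))) * word (fun _ => c ∘ q) (n + 1) v) *
      CharTwo.two_eq_zero (R := ZMod 2)

theorem prism_comap {T T' : Type*} (p' q' : T → T')
    (f : T → S) (g : T' → S') (hp : g ∘ p' = p ∘ f) (hq : g ∘ q' = q ∘ f)
    (φ : TupleCochain (n + 1) S') : prism p' q' (comap g φ) = comap f (prism p q φ) := by
  induction n with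
  | zero =>
    funext v
    change φ _ = φ _
    congr 1
    funext i
    fin_cases i
    · exact congrFun hp _
    · exact congrFun hq _
  | succ n ih =>
    funext v
    induction v using Fin.consCases with | _ x v
    have hpx : g (p' x) = p (f x) := congrFun hp x
    have hqx : g (q' x) = q (f x) := congrFun hq x
    rw [prism_cons, cone_comap, ih, hpx]
    simp only [comap, comp_cons]
    rw [prism_cons, hpx, hqx, ← Function.comp_assoc, hq]
    rfl

theorem comap_wordSum (g : S → S') (a b : S' → ZMod 2) (n : ℕ) :
    comap g (wordSum a b n) = wordSum (a ∘ g) (b ∘ g) n := by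
  induction n with
  | zero => rfl
  | succ n ih =>
    rw [wordSum, wordSum, ← ih, ← comap_word g (fun _ => b)]
    rfl

theorem wordSum_add_one (a b : S → ZMod 2) (n : ℕ) :
    wordSum a (fun x => b x + 1) n = wordSum a b n := by
  induction n with
  | zero => rfl
  | succ n ih =>
    have h : word (fun _ x => b x + 1) (n + 1) = word (fun _ => b) (n + 1) := by
      funext v
      rw [word_eq_prod, word_eq_prod]
      refine Finset.prod_congr rfl fun i _ => ?_
      linear_combination CharTwo.two_eq_zero (R := ZMod 2)
    rw [wordSum, wordSum, ih, h]

/-! ### Barycentric subdivision of tuples -/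

variable (b : ∀ n, (Fin (n + 1) → S) → S)

/-- The transpose of the subdivision operator, which sends `v` to the cone with apex `b n v` over
the subdivision of the boundary of `v`. The formal properties hold for every choice `b` of
barycentres; there is no choice in degree `0`, where the operator is the identity. -/
def subdiv (b : ∀ n, (Fin (n + 1) → S) → S) : {n : ℕ} → TupleCochain n S → TupleCochain n S
  | 0, φ => φ
  | n + 1, φ => fun v => d (subdiv b (cone (b (n + 1) v) φ)) v

/-- The transpose of a chain homotopy between the subdivision operator and the identity. -/
def subdivHomotopy (b : ∀ n, (Fin (n + 1) → S) → S) :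
    {n : ℕ} → TupleCochain (n + 1) S → TupleCochain n S
  | 0, φ => fun v => φ (Fin.cons (v 0) v)
  | n + 1, φ => fun v => φ (Fin.cons (b (n + 1) v) v) +
      d (subdivHomotopy b (cone (b (n + 1) v) φ)) v

theorem subdiv_succ_apply (φ : TupleCochain (n + 1) S) (v : Fin (n + 2) → S) :
    subdiv b φ v = d (subdiv b (cone (b (n + 1) v) φ)) v := rfl

theorem subdivHomotopy_zero_apply (φ : TupleCochain 1 S) (v : Fin 1 → S) :
    subdivHomotopy b φ v = φ (Fin.cons (v 0) v) := rfl

theorem subdivHomotopy_succ_apply (φ : TupleCochain (n + 2) S) (v : Fin (n + 2) → S) :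
    subdivHomotopy b φ v =
      φ (Fin.cons (b (n + 1) v) v) + d (subdivHomotopy b (cone (b (n + 1) v) φ)) v := rfl

theorem subdiv_add (φ ψ : TupleCochain n S) :
    subdiv b (φ + ψ) = subdiv b φ + subdiv b ψ := by
  induction n with
  | zero => rfl
  | succ n ih => funext v; simp only [subdiv, Pi.add_apply, cone_add, ih, d_add]

theorem subdiv_zero : subdiv b (0 : TupleCochain n S) = 0 := by
  simpa using subdiv_add b (0 : TupleCochain n S) 0

theorem subdivHomotopy_add (φ ψ : TupleCochain (n + 1) S) :
    subdivHomotopy b (φ + ψ) = subdivHomotopy b φ + subdivHomotopy b ψ := by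
  induction n with
  | zero => rfl
  | succ n ih =>
    funext v; simp only [subdivHomotopy, Pi.add_apply, cone_add, ih, d_add]; abel

theorem subdivHomotopy_zero : subdivHomotopy b (0 : TupleCochain (n + 1) S) = 0 := by
  simpa using subdivHomotopy_add b (0 : TupleCochain (n + 1) S) 0

theorem subdiv_d (φ : TupleCochain n S) : subdiv b (d φ) = d (subdiv b φ) := by
  induction n with
  | zero =>
    funext v
    have h : cone (b 1 v) (d φ) = φ + fun _ => φ fun _ => b 1 v :=
      funext fun w => d_cons_zero φ _ w
    rw [subdiv_succ_apply, h]
    change d (_ + _) v = d φ v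
    rw [d_add, Pi.add_apply, d_const (m := 0), add_zero]
  | succ n ih =>
    funext v
    rw [subdiv_succ_apply, cone_d, subdiv_add, d_add, ih, d_d, add_zero]

theorem subdivHomotopy_d_zero (φ : TupleCochain 0 S) : subdivHomotopy b (d φ) = 0 := by
  funext v
  rw [subdivHomotopy_zero_apply, d_cons_zero]
  have h : v = fun _ => v 0 := funext fun i => by rw [Fin.fin_one_eq_zero i]
  rw [← h]
  exact CharTwo.add_self_eq_zero _

theorem subdivHomotopy_d (φ : TupleCochain (n + 1) S) :
    subdivHomotopy b (d φ) = d (subdivHomotopy b φ) + φ + subdiv b φ := by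
  induction n with
  | zero =>
    funext v
    rw [subdivHomotopy_succ_apply, d_cons, cone_d, subdivHomotopy_add, subdivHomotopy_d_zero,
      add_zero, Pi.add_apply, Pi.add_apply, subdiv_succ_apply]
    change _ = _ + _ + d (cone _ φ) v
    ring
  | succ n ih =>
    funext v
    rw [subdivHomotopy_succ_apply, d_cons, cone_d, subdivHomotopy_add, ih, d_add, d_add, d_add, d_d]
    simp only [Pi.add_apply, subdiv, Pi.zero_apply]
    linear_combination d (cone (b (n + 2) v) φ) v * CharTwo.two_eq_zero (R := ZMod 2)

theorem comap_subdiv (b' : ∀ n, (Fin (n + 1) → S') → S') (g : S → S')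
    (hg : ∀ n v, g (b n v) = b' n (g ∘ v)) (φ : TupleCochain n S') :
    subdiv b (comap g φ) = comap g (subdiv b' φ) := by
  induction n with
  | zero => rfl
  | succ n ih =>
    funext v
    rw [subdiv_succ_apply, cone_comap, ih, hg]
    rfl

theorem comap_subdivHomotopy (b' : ∀ n, (Fin (n + 1) → S') → S') (g : S → S')
    (hg : ∀ n v, g (b n v) = b' n (g ∘ v)) (φ : TupleCochain (n + 1) S') :
    subdivHomotopy b (comap g φ) = comap g (subdivHomotopy b' φ) := by
  induction n with
  | zero =>
    funext v
    simp only [subdivHomotopy, comap, comp_cons]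
    rfl
  | succ n ih =>
    funext v
    rw [subdivHomotopy_succ_apply, cone_comap, ih, d_comap, hg]
    simp only [comap, comp_cons]
    rw [hg]
    rfl

theorem iterate_subdiv_d (φ : TupleCochain n S) (N : ℕ) (h : d φ = 0) :
    d ((subdiv b)^[N] φ) = 0 := by
  induction N with
  | zero => exact h
  | succ N ih => rw [Function.iterate_succ_apply', ← subdiv_d, ih, subdiv_zero]

theorem d_sum_subdivHomotopy (φ : TupleCochain (n + 1) S) (N : ℕ) (h : d φ = 0) :
    d (∑ i ∈ Finset.range N, subdivHomotopy b ((subdiv b)^[i] φ)) =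
      φ + (subdiv b)^[N] φ := by
  induction N with
  | zero => rw [Finset.sum_range_zero, d_zero]; exact (add_self φ).symm
  | succ N ih =>
    have e := subdivHomotopy_d b ((subdiv b)^[N] φ)
    rw [iterate_subdiv_d b φ N h, subdivHomotopy_zero] at e
    rw [Finset.sum_range_succ, d_add, ih, Function.iterate_succ_apply']
    generalize (subdiv b)^[N] φ = ψ at *
    generalize d (subdivHomotopy b ψ) = x at *
    have : x = ψ + subdiv b ψ := by
      rw [← add_zero x, ← add_self (ψ + subdiv b ψ), ← add_assoc, ← add_assoc x, ← e, zero_add]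
    rw [this, show φ + ψ + (ψ + subdiv b ψ) = φ + (ψ + ψ) + subdiv b ψ by abel, add_self, add_zero]

end TupleCochain

/-! ### The theorem of small simplices -/

namespace SingularZ2

variable {B : Type u} [TopologicalSpace B] {n k : ℕ}

/-- The affine map of standard simplices given by the images of the vertices. -/
noncomputable def affineMap (u : Fin (n + 1) → stdSimplex ℝ (Fin (k + 1))) :
    C(stdSimplex ℝ (Fin (n + 1)), stdSimplex ℝ (Fin (k + 1))) where
  toFun x := ⟨∑ i, x i • (u i).1, (convex_stdSimplex ℝ _).sum_mem
    (fun i _ => x.2.1 i) x.2.2 fun i _ => (u i).2⟩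
  continuous_toFun := by
    refine Continuous.subtype_mk (continuous_finsetSum _ fun i _ => ?_) _
    exact ((continuous_apply i).comp continuous_subtype_val).smul continuous_const

theorem coe_affineMap (u : Fin (n + 1) → stdSimplex ℝ (Fin (k + 1)))
    (x : stdSimplex ℝ (Fin (n + 1))) :
    (affineMap u x).1 = ∑ i, x i • (u i).1 := rfl

theorem affine_apply (a : Fin (n + 1) → Fin (k + 1)) (x : stdSimplex ℝ (Fin (n + 1)))
    (j : Fin (k + 1)) : (affine a x).1 j = ∑ i, if a i = j then x i else 0 := by
  change FunOnFinite.linearMap ℝ ℝ a x j = _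
  rw [FunOnFinite.linearMap_apply_apply, Finset.sum_filter]

theorem affineMap_comp_affine {m : ℕ} (u : Fin (n + 1) → stdSimplex ℝ (Fin (k + 1)))
    (a : Fin (m + 1) → Fin (n + 1)) : (affineMap u).comp (affine a) = affineMap (u ∘ a) := by
  ext1 x
  apply Subtype.ext
  rw [ContinuousMap.comp_apply, coe_affineMap, coe_affineMap]
  have : ∀ j, (affine a x) j = ∑ i, if a i = j then x i else 0 := affine_apply a x
  simp only [this, Finset.sum_smul, ite_smul, zero_smul]
  rw [Finset.sum_comm]
  simp

theorem affine_comp_affineMap {m : ℕ} (u : Fin (n + 1) → stdSimplex ℝ (Fin (k + 1)))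
    (a : Fin (k + 1) → Fin (m + 1)) : (affine a).comp (affineMap u) = affineMap (affine a ∘ u) := by
  ext1 x
  apply Subtype.ext
  funext j
  rw [ContinuousMap.comp_apply, affine_apply, coe_affineMap, Finset.sum_apply]
  have (i : Fin (k + 1)) : affineMap u x i = ∑ l, x l * u l i := by
    change (affineMap u x).1 i = _
    rw [coe_affineMap, Finset.sum_apply]
    rfl
  simp only [this, Pi.smul_apply, Function.comp_apply, affine_apply, smul_eq_mul, Finset.mul_sum]
  rw [Finset.sum_comm]
  refine Finset.sum_congr rfl fun i _ => ?_
  split_ifs with h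
  · rfl
  · rw [Finset.sum_eq_zero]
    intro l _
    exact mul_zero _

theorem affineMap_vertex (k : ℕ) :
    affineMap (fun i : Fin (k + 1) => stdSimplex.vertex (S := ℝ) i) = ContinuousMap.id _ := by
  ext1 x
  apply Subtype.ext
  rw [coe_affineMap]
  funext j
  simp [Finset.sum_apply, Pi.single_apply]
  rfl

theorem affine_vertex (a : Fin (n + 1) → Fin (k + 1)) (i : Fin (n + 1)) :
    affine a (stdSimplex.vertex i) = stdSimplex.vertex (a i) := stdSimplex.map_vertex a i

/-- The barycentre of a tuple of points, with multiplicities. -/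
noncomputable def tupleBarycenter (k n : ℕ) (u : Fin (n + 1) → stdSimplex ℝ (Fin (k + 1))) :
    stdSimplex ℝ (Fin (k + 1)) :=
  affineMap u stdSimplex.barycenter

theorem affine_tupleBarycenter {m : ℕ} (a : Fin (k + 1) → Fin (m + 1)) (n : ℕ)
    (u : Fin (n + 1) → stdSimplex ℝ (Fin (k + 1))) :
    affine a (tupleBarycenter k n u) = tupleBarycenter m n (affine a ∘ u) :=
  DFunLike.congr_fun (affine_comp_affineMap u a) _

theorem dist_tupleBarycenter_le (u : Fin (n + 1) → stdSimplex ℝ (Fin (k + 1))) {D : ℝ}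
    (hu : ∀ i j, dist (u i) (u j) ≤ D) (i : Fin (n + 1)) :
    dist (tupleBarycenter k n u) (u i) ≤ n / (n + 1) * D := by
  have hpos : (0 : ℝ) < n + 1 := by positivity
  rw [Subtype.dist_eq, dist_eq_norm]
  have e : (tupleBarycenter k n u).1 - (u i).1 =
      ∑ j, ((n + 1 : ℝ)⁻¹) • ((u j).1 - (u i).1) := by
    have h1 : ∀ j : Fin (n + 1),
        (stdSimplex.barycenter : stdSimplex ℝ (Fin (n + 1))) j = (n + 1 : ℝ)⁻¹ := by
      intro j
      change (Fintype.card (Fin (n + 1)) : ℝ)⁻¹ = _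
      simp
    rw [tupleBarycenter, coe_affineMap]
    simp only [h1, smul_sub, Finset.sum_sub_distrib, Finset.sum_const, Finset.card_univ,
      Fintype.card_fin]
    rw [← Nat.cast_smul_eq_nsmul ℝ, smul_smul, Nat.cast_succ, mul_inv_cancel₀ hpos.ne', one_smul]
  rw [e]
  refine (norm_sum_le _ _).trans ?_
  have h2 : ∀ j ∈ Finset.univ, ‖((n + 1 : ℝ)⁻¹) • ((u j).1 - (u i).1)‖ ≤
      if j = i then 0 else (n + 1 : ℝ)⁻¹ * D := by
    intro j _
    split_ifs with h
    · rw [h, sub_self, smul_zero, norm_zero]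
    · rw [norm_smul, norm_inv, Real.norm_of_nonneg hpos.le, ← dist_eq_norm, ← Subtype.dist_eq]
      exact mul_le_mul_of_nonneg_left (hu j i) (by positivity)
  refine (Finset.sum_le_sum h2).trans (le_of_eq ?_)
  rw [Finset.sum_ite, Finset.sum_const_zero, zero_add, Finset.sum_const, nsmul_eq_mul,
    Finset.filter_ne', Finset.card_erase_of_mem (Finset.mem_univ _), Finset.card_univ,
    Fintype.card_fin, Nat.add_sub_cancel]
  ring

/-- Subdivision shrinks simplices: the simplices in the subdivision of an `n`-simplex of diameter at
most `D` have diameter at most `K / (K + 1) * D`, for every `K ≥ n`. The convex set `C` serves the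
induction, in which it is replaced by its intersection with a ball around the barycentre. -/
theorem subdiv_eq_zero {K : ℕ} (hn : n ≤ K) {D : ℝ} (hD : 0 ≤ D)
    (φ : TupleCochain n (stdSimplex ℝ (Fin (k + 1)))) (C : Set (Fin (k + 1) → ℝ))
    (hC : Convex ℝ C)
    (hφ : ∀ u, (∀ i, (u i).1 ∈ C) →
      (∀ i j, dist (u i) (u j) ≤ K / (K + 1) * D) → φ u = 0)
    (v : Fin (n + 1) → stdSimplex ℝ (Fin (k + 1))) (hvC : ∀ i, (v i).1 ∈ C)
    (hv : ∀ i j, dist (v i) (v j) ≤ D) :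
    TupleCochain.subdiv (tupleBarycenter k) φ v = 0 := by
  induction n generalizing C with
  | zero =>
    refine hφ v hvC fun i j => ?_
    rw [Fin.fin_one_eq_zero i, Fin.fin_one_eq_zero j, dist_self]
    positivity
  | succ n ih =>
    set b := tupleBarycenter k (n + 1) v with hb
    have hbv : ∀ i, dist (v i) b ≤ K / (K + 1) * D := by
      intro i
      rw [dist_comm]
      refine (dist_tupleBarycenter_le v hv i).trans (mul_le_mul_of_nonneg_right ?_ hD)
      have : ((n + 1 : ℕ) : ℝ) ≤ K := by exact_mod_cast hn
      rw [div_le_div_iff₀ (by positivity) (by positivity)]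
      linarith
    have hbC : b.1 ∈ C :=
      hC.sum_mem (fun i _ => (stdSimplex.barycenter : stdSimplex ℝ (Fin (n + 2))).2.1 i)
        (stdSimplex.barycenter : stdSimplex ℝ (Fin (n + 2))).2.2 fun i _ => hvC i
    rw [TupleCochain.subdiv_succ_apply]
    refine Finset.sum_eq_zero fun i _ => ?_
    refine ih (by omega) _ (C ∩ Metric.closedBall b (K / (K + 1) * D))
      (hC.inter (convex_closedBall _ _)) ?_ _ ?_ ?_
    · intro w hwC hw
      refine hφ _ ?_ ?_
      · intro j
        refine Fin.cases ?_ (fun j => ?_) j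
        · exact hbC
        · exact (hwC j).1
      · have h1 : ∀ j, dist (w j) b ≤ K / (K + 1) * D := fun j => (hwC j).2
        intro j l
        refine Fin.cases ?_ (fun j => ?_) j <;> refine Fin.cases ?_ (fun l => ?_) l
        · rw [dist_self]; positivity
        · rw [dist_comm]; exact h1 l
        · exact h1 j
        · exact hw j l
    · exact fun j => ⟨hvC _, hbv _⟩
    · exact fun j l => hv _ _

theorem iterate_subdiv_eq_zero (N : ℕ) {D : ℝ} (hD : 0 ≤ D)
    (φ : TupleCochain n (stdSimplex ℝ (Fin (k + 1))))
    (hφ : ∀ u, (∀ i j, dist (u i) (u j) ≤ (n / (n + 1)) ^ N * D) → φ u = 0)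
    (v : Fin (n + 1) → stdSimplex ℝ (Fin (k + 1))) (hv : ∀ i j, dist (v i) (v j) ≤ D) :
    (TupleCochain.subdiv (tupleBarycenter k))^[N] φ v = 0 := by
  induction N generalizing φ with
  | zero => exact hφ v (by simpa using hv)
  | succ N ih =>
    rw [Function.iterate_succ_apply]
    refine ih _ fun u hu => ?_
    refine subdiv_eq_zero le_rfl (by positivity) φ Set.univ convex_univ
      (fun w _ hw => hφ w fun i j => ?_) u (fun _ => Set.mem_univ _) hu
    exact (hw i j).trans (le_of_eq (by ring))

/-- The restriction of a singular cochain to the affine simplices in a singular simplex. -/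
noncomputable def onSimplex (Φ : Cochain n B) (σ : Simplex k B) :
    TupleCochain n (stdSimplex ℝ (Fin (k + 1))) :=
  fun u => Φ (σ.comp (affineMap u))

theorem d_onSimplex (Φ : Cochain n B) (σ : Simplex k B) :
    TupleCochain.d (onSimplex Φ σ) = onSimplex (coboundary n B Φ) σ := by
  funext u
  refine Finset.sum_congr rfl fun i _ => ?_
  rw [onSimplex, face, ContinuousMap.comp_assoc, affineMap_comp_affine]

theorem onSimplex_face (Φ : Cochain n B) (σ : Simplex (k + 1) B) (i : Fin (k + 2)) :
    onSimplex Φ (face i σ) = TupleCochain.comap (affine i.succAbove) (onSimplex Φ σ) := by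
  funext u
  rw [onSimplex, face, ContinuousMap.comp_assoc, affine_comp_affineMap]
  rfl

theorem onSimplex_vertex (Φ : Cochain n B) (σ : Simplex n B) :
    onSimplex Φ σ (fun i => stdSimplex.vertex i) = Φ σ := by
  rw [onSimplex, affineMap_vertex, ContinuousMap.comp_id]

/-- The subdivisions of all affine simplices in a singular simplex become small at the same time, by
the lemma of Lebesgue. -/
theorem exists_iterate_subdiv_onSimplex_eq_zero {ι : Type*} (U : ι → Set B)
    (hU : ∀ i, IsOpen (U i)) (hcov : ∀ x, ∃ i, x ∈ U i) (Φ : Cochain n B)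
    (hΦ : ∀ (σ : Simplex n B) (i : ι), (∀ x, σ x ∈ U i) → Φ σ = 0) (σ : Simplex k B) :
    ∃ N, ∀ m, N ≤ m →
      (TupleCochain.subdiv (tupleBarycenter k))^[m] (onSimplex Φ σ) = 0 := by
  obtain ⟨δ, hδ, hleb⟩ := lebesgue_number_lemma_of_metric (s := Set.univ)
    (c := fun i => σ ⁻¹' U i) isCompact_univ (fun i => (hU i).preimage σ.continuous)
    (fun x _ => Set.mem_iUnion.2 (hcov (σ x)))
  have hlim : Filter.Tendsto (fun m : ℕ => ((n : ℝ) / (n + 1)) ^ m) Filter.atTop (nhds 0) :=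
    tendsto_pow_atTop_nhds_zero_of_lt_one (by positivity)
      ((div_lt_one (by positivity)).2 (by linarith))
  obtain ⟨N, hN⟩ := Filter.eventually_atTop.1 (hlim.eventually (gt_mem_nhds hδ))
  refine ⟨N, fun m hm => funext fun v => ?_⟩
  refine iterate_subdiv_eq_zero m zero_le_one _ (fun u hu => ?_) v fun i j => ?_
  · obtain ⟨i, hi⟩ := hleb (u 0) (Set.mem_univ _)
    refine hΦ _ i fun x => hi ?_
    rw [Metric.mem_ball, Subtype.dist_eq, ← Metric.mem_ball]
    refine (convex_ball _ _).sum_mem (fun i _ => x.2.1 i) x.2.2 fun j _ => ?_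
    change dist (u j) (u 0) < δ
    exact (hu j 0).trans_lt (by rw [mul_one]; exact hN m hm)
  · rw [Subtype.dist_eq]
    exact (Metric.dist_le_diam_of_mem (bounded_stdSimplex (Fin (k + 1))) (v i).2 (v j).2).trans
      diam_stdSimplex_le

/-- A cocycle that vanishes on the small simplices of an open cover is a coboundary. With `T` the
chain homotopy between the subdivision operator `S` and the identity, a primitive of `Φ` is
`σ ↦ ∑ᵢ Φ(Sⁱ(T σ))`, a sum with finitely many nonzero terms for each `σ`. -/
theorem mem_coboundaries_of_small {ι : Type*} (U : ι → Set B)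
    (hU : ∀ i, IsOpen (U i)) (hcov : ∀ x, ∃ i, x ∈ U i) (Φ : Cochain (n + 1) B)
    (hΦ : ∀ (σ : Simplex (n + 1) B) (i : ι), (∀ x, σ x ∈ U i) → Φ σ = 0)
    (hc : Φ ∈ cocycles (n + 1) B) : Φ ∈ coboundaries (n + 1) B := by
  choose N hN using fun σ : Simplex n B =>
    exists_iterate_subdiv_onSimplex_eq_zero U hU hcov Φ hΦ σ
  let T (k : ℕ) (σ : Simplex k B) (i : ℕ) : TupleCochain n (stdSimplex ℝ (Fin (k + 1))) :=
    TupleCochain.subdivHomotopy (tupleBarycenter k)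
      ((TupleCochain.subdiv (tupleBarycenter k))^[i] (onSimplex Φ σ))
  refine ⟨fun σ => ∑ i ∈ Finset.range (N σ), T n σ i fun j => stdSimplex.vertex j, ?_⟩
  funext σ
  have hΦ0 : coboundary _ B Φ = 0 := hc
  obtain ⟨M₀, hM₀⟩ := exists_iterate_subdiv_onSimplex_eq_zero U hU hcov Φ hΦ σ
  -- a bound beyond which the terms vanish for `σ` and for all its faces
  let M := M₀ + ∑ i, N (face i σ)
  have hM : ∀ i, N (face i σ) ≤ M := fun i =>
    (Finset.single_le_sum (f := fun i => N (face i σ)) (fun _ _ => Nat.zero_le _)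
      (Finset.mem_univ i)).trans (Nat.le_add_left _ _)
  have hext : ∀ i, ∑ l ∈ Finset.range (N (face i σ)),
      T n (face i σ) l (fun j => stdSimplex.vertex j) =
      ∑ l ∈ Finset.range M, T n (face i σ) l (fun j => stdSimplex.vertex j) := by
    intro i
    refine Finset.sum_subset (Finset.range_subset_range.2 (hM i)) fun l _ hl => ?_
    rw [Finset.mem_range, not_lt] at hl
    change TupleCochain.subdivHomotopy _ _ _ = 0
    rw [hN _ l hl, TupleCochain.subdivHomotopy_zero]
    rfl
  have hnat : ∀ i l, T n (face i σ) l (fun j => stdSimplex.vertex j) =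
      T (n + 1) σ l ((fun j => stdSimplex.vertex j) ∘ i.succAbove) := by
    intro i l
    have hg := affine_tupleBarycenter (i.succAbove : Fin (n + 1) → Fin (n + 2))
    have h1 : ∀ m, (TupleCochain.subdiv (tupleBarycenter n))^[m] (onSimplex Φ (face i σ)) =
        TupleCochain.comap (affine i.succAbove)
          ((TupleCochain.subdiv (tupleBarycenter (n + 1)))^[m] (onSimplex Φ σ)) := by
      intro m
      induction m with
      | zero => exact onSimplex_face Φ σ i
      | succ m ih =>
        rw [Function.iterate_succ_apply', ih, Function.iterate_succ_apply',
          TupleCochain.comap_subdiv _ _ _ hg]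
    change TupleCochain.subdivHomotopy _ _ _ = _
    rw [h1, TupleCochain.comap_subdivHomotopy _ _ _ hg]
    change T (n + 1) σ l _ = _
    congr 1
    funext j
    exact affine_vertex _ _
  have hsum := congrFun (TupleCochain.d_sum_subdivHomotopy (tupleBarycenter (n + 1))
    (onSimplex Φ σ) M (by rw [d_onSimplex, hΦ0]; rfl)) fun j => stdSimplex.vertex j
  rw [hM₀ M (Nat.le_add_right _ _), add_zero, onSimplex_vertex] at hsum
  rw [← hsum]
  change ∑ i : Fin (n + 2), _ = ∑ i : Fin (n + 2), _
  refine Finset.sum_congr rfl fun i _ => ?_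
  refine (hext i).trans ?_
  rw [Finset.sum_apply]
  exact Finset.sum_congr rfl fun l _ => hnat i l

end SingularZ2

/-! ### Cochains on the orbit space -/

namespace SingularZ2

variable {B : Type u} [TopologicalSpace B] {n : ℕ}

/-- The singular cochain that depends on the vertices of a simplex only, through `φ`. -/
noncomputable def ofTuple (φ : TupleCochain n B) : Cochain n B :=
  fun s => φ fun i => s (stdSimplex.vertex i)

theorem face_vertex (s : Simplex (n + 1) B) (i : Fin (n + 2)) (j : Fin (n + 1)) :
    face i s (stdSimplex.vertex j) = s (stdSimplex.vertex (i.succAbove j)) := by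
  rw [← affine_vertex]; rfl

theorem coboundary_ofTuple (φ : TupleCochain n B) :
    coboundary n B (ofTuple φ) = ofTuple (TupleCochain.d φ) := by
  funext s
  change ∑ i : Fin (n + 2), _ = ∑ i : Fin (n + 2), _
  refine Finset.sum_congr rfl fun i _ => ?_
  simp only [ofTuple, face_vertex]
  rfl

theorem mem_coboundaries_zero_iff {φ : Cochain 0 B} : φ ∈ coboundaries 0 B ↔ φ = 0 := Iff.rfl

theorem cls_eq_zero_iff (c : cocycles n B) : cls c = 0 ↔ c.1 ∈ coboundaries n B :=
  (Submodule.Quotient.mk_eq_zero _)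

instance (n : ℕ) : ContractibleSpace (stdSimplex ℝ (Fin (n + 1))) :=
  (convex_stdSimplex ℝ _).contractibleSpace ⟨_, (stdSimplex.vertex 0).2⟩

instance (n : ℕ) : LocallyPathConnectedSpace (stdSimplex ℝ (Fin (n + 1))) :=
  (convex_stdSimplex ℝ _).locallyPathConnectedSpace

end SingularZ2

namespace FreeZ2Space

open SingularZ2

variable (X : FreeZ2Space.{u})

/-- The projection to the orbit space. -/
def proj : C(X, X.Orbits) := ⟨Quot.mk _, continuous_quot_mk⟩

theorem proj_τ (x : X) : X.proj (X.τ x) = X.proj x :=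
  (Quot.sound (r := fun x y : X => y = X.τ x) rfl).symm

theorem proj_eq_iff {x y : X} : X.proj x = X.proj y ↔ x = y ∨ x = X.τ y := by
  constructor
  · intro h
    let F : X.Orbits → Set X := Quot.lift (fun z => {z, X.τ z}) (by
      rintro a b rfl
      rw [X.involutive, Set.pair_comm])
    have : x ∈ F (X.proj y) := h ▸ (Or.inl rfl : x ∈ ({x, X.τ x} : Set X))
    exact this
  · rintro (rfl | rfl)
    · rfl
    · exact X.proj_τ y

/-- The action of the group `{1, -1}` in which `-1` acts by the involution. -/
noncomputable abbrev action : MulAction ℤˣ X where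
  smul g x := if g = 1 then x else X.τ x
  one_smul x := if_pos rfl
  mul_smul g h x := by
    change (if g * h = 1 then x else X.τ x) =
      if g = 1 then (if h = 1 then x else X.τ x) else X.τ (if h = 1 then x else X.τ x)
    obtain rfl | rfl := Int.units_eq_one_or g <;> obtain rfl | rfl := Int.units_eq_one_or h <;>
      simp [X.involutive]

theorem isCoveringMap_proj [T2Space X] : IsCoveringMap X.proj := by
  let _ := X.action
  have hneg : ∀ x : X, (-1 : ℤˣ) • x = X.τ x := fun x => if_neg (by decide)
  suffices h : IsQuotientCoveringMap X.proj ℤˣ from h.isCoveringMap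
  refine { toIsQuotientMap := isQuotientMap_quot_mk, continuous_const_smul := ?_,
           apply_eq_iff_mem_orbit := ?_, disjoint := ?_ }
  · intro g
    obtain rfl | rfl := Int.units_eq_one_or g
    · simpa using continuous_id'
    · simpa only [hneg] using X.τ.continuous
  · intro x y
    rw [proj_eq_iff]
    constructor
    · rintro (rfl | rfl)
      · exact ⟨1, one_smul _ _⟩
      · exact ⟨-1, hneg y⟩
    · rintro ⟨g, rfl⟩
      obtain rfl | rfl := Int.units_eq_one_or g
      · exact Or.inl (one_smul _ _)
      · exact Or.inr (hneg y)
  · intro x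
    obtain ⟨U, V, hU, hV, hxU, hxV, hUV⟩ := t2_separation (X.free x)
    refine ⟨V ∩ X.τ ⁻¹' U, (hV.inter (hU.preimage X.τ.continuous)).mem_nhds ⟨hxV, hxU⟩, ?_⟩
    rintro g ⟨_, ⟨y, hy, rfl⟩, hy'⟩
    obtain rfl | rfl := Int.units_eq_one_or g
    · rfl
    · exfalso
      simp only [hneg] at hy'
      exact Set.disjoint_left.1 hUV hy.2 hy'.1

variable {X}

theorem exists_lift [T2Space X] {n : ℕ} (σ : Simplex n X.Orbits) :
    ∃ s : Simplex n X, X.proj.comp s = σ := by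
  obtain ⟨x, hx⟩ := Quot.exists_rep (σ (stdSimplex.vertex 0))
  obtain ⟨s, hs, -⟩ := X.isCoveringMap_proj.existsUnique_continuousMap_lifts σ _ x hx
  exact ⟨s, ContinuousMap.coe_injective hs.2⟩

theorem lift_unique [T2Space X] {n : ℕ} {s t : Simplex n X} (h : X.proj.comp s = X.proj.comp t) :
    s = t ∨ s = X.τ.comp t := by
  have h0 := DFunLike.congr_fun h (stdSimplex.vertex 0)
  refine (X.proj_eq_iff.1 h0).imp (fun h1 => ?_) fun h1 => ?_
  · exact ContinuousMap.coe_injective (X.isCoveringMap_proj.eq_of_comp_eq s.continuous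
      t.continuous (congrArg DFunLike.coe h) _ h1)
  · refine ContinuousMap.coe_injective (X.isCoveringMap_proj.eq_of_comp_eq s.continuous
      (X.τ.comp t).continuous ?_ _ h1)
    funext x
    exact (DFunLike.congr_fun h x).trans (X.proj_τ _).symm

/-- A lift of a singular simplex of the orbit space. -/
noncomputable def lift [T2Space X] {n : ℕ} (σ : Simplex n X.Orbits) : Simplex n X :=
  (exists_lift σ).choose

theorem proj_comp_lift [T2Space X] {n : ℕ} (σ : Simplex n X.Orbits) :
    X.proj.comp (lift σ) = σ := (exists_lift σ).choose_spec

theorem proj_comp_τ : X.proj.comp X.τ = X.proj := ContinuousMap.ext X.proj_τ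

/-- The cochain on the orbit space whose value on a simplex is the value of `ψ` on one of its two
lifts. It is meaningful for invariant `ψ`, when the choice of the lift does not matter. -/
noncomputable def descend [T2Space X] {n : ℕ} (ψ : Cochain n X) : Cochain n X.Orbits :=
  fun σ => ψ (lift σ)

/-- Invariance of a cochain under the involution. -/
def Invariant {n : ℕ} (ψ : Cochain n X) : Prop := ∀ s, ψ (X.τ.comp s) = ψ s

theorem descend_proj_comp [T2Space X] {n : ℕ} {ψ : Cochain n X} (hψ : Invariant ψ)
    (s : Simplex n X) : descend ψ (X.proj.comp s) = ψ s := by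
  obtain h | h := lift_unique (proj_comp_lift (X.proj.comp s))
  · rw [descend, h]
  · rw [descend, h, hψ]

theorem Invariant.coboundary {n : ℕ} {ψ : Cochain n X} (hψ : Invariant ψ) :
    Invariant (coboundary n X ψ) := fun s =>
  Finset.sum_congr (s₁ := Finset.univ) rfl fun i _ => hψ (face i s)

theorem eq_of_forall_proj_comp [T2Space X] {n : ℕ} {φ ψ : Cochain n X.Orbits}
    (h : ∀ s : Simplex n X, φ (X.proj.comp s) = ψ (X.proj.comp s)) : φ = ψ :=
  funext fun σ => by rw [← proj_comp_lift σ]; exact h _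

theorem coboundary_descend [T2Space X] {n : ℕ} {ψ : Cochain n X} (hψ : Invariant ψ) :
    SingularZ2.coboundary n X.Orbits (descend ψ) = descend (SingularZ2.coboundary n X ψ) := by
  refine eq_of_forall_proj_comp fun s => ?_
  rw [descend_proj_comp hψ.coboundary]
  exact Finset.sum_congr (s₁ := Finset.univ) rfl fun i _ => descend_proj_comp hψ (face i s)

/-- A function with values in `ZMod 2`, not assumed continuous, that takes different values at the
two points of each orbit. It is the same as a set-theoretic section of the projection to the orbits.
-/
def IsSign (ε : X → ZMod 2) : Prop := ∀ x, ε (X.τ x) = ε x + 1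

theorem exists_isSign (X : FreeZ2Space.{u}) : ∃ ε : X → ZMod 2, IsSign ε := by
  classical
  let r : X → X := fun x => Quot.out (X.proj x)
  have hr : ∀ x, x = r x ∨ x = X.τ (r x) := fun x =>
    X.proj_eq_iff.1 (Quot.out_eq (X.proj x)).symm
  refine ⟨fun x => if x = r x then 0 else 1, fun x => ?_⟩
  have h : r (X.τ x) = r x := congrArg Quot.out (X.proj_τ x)
  simp only [h]
  obtain e | e := hr x
  · rw [← e, if_neg (X.free x), if_pos rfl, zero_add]
  · have h1 : X.τ x = r x := by rw [e, X.involutive, ← e]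
    have h2 : x ≠ r x := fun h3 => X.free x (h1.trans h3.symm)
    rw [if_pos h1, if_neg h2]
    decide

theorem IsSign.add_apply_τ {ε δ : X → ZMod 2} (hε : IsSign ε) (hδ : IsSign δ) (x y : X) :
    ε (X.τ x) + δ (X.τ y) = ε x + δ y := by
  rw [hε, hδ]
  linear_combination CharTwo.two_eq_zero (R := ZMod 2)

theorem invariant_ofTuple {n : ℕ} {φ : TupleCochain n X} (h : TupleCochain.comap X.τ φ = φ) :
    Invariant (ofTuple φ) := fun _ => congrFun h _

theorem comap_τ_word {a : ℕ → X → ZMod 2} (ha : ∀ i, IsSign (a i)) (n : ℕ) :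
    TupleCochain.comap X.τ (TupleCochain.word a n) = TupleCochain.word a n := by
  funext v
  simp only [TupleCochain.comap, TupleCochain.word_eq_prod]
  exact Finset.prod_congr rfl fun i _ => (ha i).add_apply_τ (ha i) _ _

theorem comap_τ_wordHomotopy {a b : ℕ → X → ZMod 2} (ha : ∀ i, IsSign (a i))
    (hb : ∀ i, IsSign (b i)) (n : ℕ) :
    TupleCochain.comap X.τ (TupleCochain.wordHomotopy a b n) =
      TupleCochain.wordHomotopy a b n := by
  induction n generalizing a b with
  | zero => exact funext fun v => (ha 0).add_apply_τ (hb 0) _ _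
  | succ n ih =>
    funext v
    have h1 := congrFun (ih (fun i => ha (i + 1)) fun i => hb (i + 1)) (Fin.tail v)
    have h2 := congrFun (comap_τ_word (fun i => hb (i + 1)) (n + 1)) v
    simp only [TupleCochain.comap] at h1 h2
    simp only [TupleCochain.comap, TupleCochain.wordHomotopy, Pi.add_apply, TupleCochain.dcup,
      TupleCochain.cupZero, h2, Function.comp_apply, (ha 0).add_apply_τ (ha 0),
      (ha 0).add_apply_τ (hb 0)]
    congr 2

/-- The cochain on the orbit space with value `∏ᵢ (aᵢ(vᵢ) + aᵢ(vᵢ₊₁))` on a simplex, where the `vᵢ`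
are the vertices of a lift. If all `aᵢ` are sign functions, it represents the `n`-th power of the
class of the double covering. -/
noncomputable def wordCochain [T2Space X] (a : ℕ → X → ZMod 2) (n : ℕ) : Cochain n X.Orbits :=
  descend (ofTuple (TupleCochain.word a n))

variable [T2Space X] {a b : ℕ → X → ZMod 2}

theorem wordCochain_proj_comp (ha : ∀ i, IsSign (a i)) {n : ℕ} (s : Simplex n X) :
    wordCochain a n (X.proj.comp s) =
      TupleCochain.word a n fun i => s (stdSimplex.vertex i) :=
  descend_proj_comp (invariant_ofTuple (comap_τ_word ha n)) s

theorem wordCochain_mem_cocycles (ha : ∀ i, IsSign (a i)) (n : ℕ) :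
    wordCochain a n ∈ cocycles n X.Orbits := by
  change coboundary _ _ (descend _) = 0
  rw [coboundary_descend (invariant_ofTuple (comap_τ_word ha n)), coboundary_ofTuple,
    TupleCochain.d_word]
  rfl

theorem wordCochain_add_mem (ha : ∀ i, IsSign (a i)) (hb : ∀ i, IsSign (b i)) (n : ℕ) :
    wordCochain a n + wordCochain b n ∈ coboundaries n X.Orbits := by
  cases n with
  | zero => exact TupleCochain.add_self _
  | succ n =>
    refine ⟨descend (ofTuple (TupleCochain.wordHomotopy a b n)), ?_⟩
    rw [coboundary_descend (invariant_ofTuple (comap_τ_wordHomotopy ha hb n)), coboundary_ofTuple,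
      TupleCochain.d_wordHomotopy]
    rfl

theorem wordCochain_mem_of_mem (ha : ∀ i, IsSign (a i)) (hb : ∀ i, IsSign (b i)) {n : ℕ}
    (h : wordCochain a n ∈ coboundaries n X.Orbits) :
    wordCochain b n ∈ coboundaries n X.Orbits := by
  have := Submodule.add_mem _ h (wordCochain_add_mem ha hb n)
  rwa [← add_assoc, TupleCochain.add_self, zero_add] at this

end FreeZ2Space

/-! ### The prism operator for singular cochains -/

namespace SingularZ2

variable {X : Type u} {Z : Type v} [TopologicalSpace X] [TopologicalSpace Z] {n m k : ℕ}

/-- The simplex in `Z` that `h` and `s` associate with a tuple of vertices of the prism over the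
standard simplex. -/
noncomputable def prismSimplex (h : C(stdSimplex ℝ (Fin 2) × X, Z)) (s : Simplex k X)
    (w : Fin (n + 1) → Fin 2 × Fin (k + 1)) : Simplex n Z :=
  h.comp ((affine fun i => (w i).1).prodMk (s.comp (affine fun i => (w i).2)))

/-- The cochain on the tuples of vertices of the prism induced by a singular cochain. -/
noncomputable def onPrism (h : C(stdSimplex ℝ (Fin 2) × X, Z)) (u : Cochain n Z)
    (s : Simplex k X) : TupleCochain n (Fin 2 × Fin (k + 1)) :=
  fun w => u (prismSimplex h s w)

/-- The transpose of the prism operator of a homotopy `h` whose parameter runs through the standard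
`1`-simplex. -/
noncomputable def prismCochain (h : C(stdSimplex ℝ (Fin 2) × X, Z)) (u : Cochain (n + 1) Z) :
    Cochain n X :=
  fun s => TupleCochain.prism (fun i => ((0 : Fin 2), i)) (fun i => (1, i)) (onPrism h u s) id

variable (h : C(stdSimplex ℝ (Fin 2) × X, Z))

theorem d_onPrism (u : Cochain n Z) (s : Simplex k X) :
    TupleCochain.d (onPrism h u s) = onPrism h (coboundary n Z u) s := by
  funext w
  refine Finset.sum_congr rfl fun i _ => ?_
  have h1 (a : Fin (n + 2) → Fin 2) : affine (a ∘ i.succAbove) =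
    (affine a).comp (affine i.succAbove) := (affine_comp_affine _ _).symm
  have h2 (a : Fin (n + 2) → Fin (k + 1)) : affine (a ∘ i.succAbove) =
    (affine a).comp (affine i.succAbove) := (affine_comp_affine _ _).symm
  change u (h.comp ((affine ((fun i => (w i).1) ∘ i.succAbove)).prodMk
    (s.comp (affine ((fun i => (w i).2) ∘ i.succAbove))))) = _
  rw [h1, h2]
  rfl

theorem onPrism_face (u : Cochain n Z) (s : Simplex (k + 1) X) (i : Fin (k + 2)) :
    onPrism h u (face i s) = TupleCochain.comap (Prod.map id i.succAbove) (onPrism h u s) := by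
  funext w
  have h2 (a : Fin (n + 1) → Fin (k + 1)) : affine (i.succAbove ∘ a) =
    (affine i.succAbove).comp (affine a) := (affine_comp_affine _ _).symm
  change _ = u (h.comp ((affine (fun i => (w i).1)).prodMk
    (s.comp (affine (i.succAbove ∘ (fun i => (w i).2))))))
  rw [h2]
  rfl

/-- The map at one end of a homotopy. -/
noncomputable def atVertex (a : Fin 2) : C(X, Z) :=
  h.comp ((ContinuousMap.const X (stdSimplex.vertex a)).prodMk (ContinuousMap.id X))

theorem prismSimplex_const (a : Fin 2) (s : Simplex n X) :
    prismSimplex h s (fun i => (a, i)) = (atVertex h a).comp s := by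
  have h1 : affine (fun _ : Fin (n + 1) => a) =
      ContinuousMap.const _ (stdSimplex.vertex (S := ℝ) a) := by
    ext1 x
    apply Subtype.ext
    funext j
    rw [affine_apply]
    by_cases haj : a = j
    · subst haj; simp
    · simp [haj, Ne.symm haj]
  have h2 : affine (fun i : Fin (n + 1) => i) = ContinuousMap.id _ := by
    ext1 x
    exact stdSimplex.map_id_apply x
  simp only [prismSimplex]
  rw [h1, h2]
  rfl

theorem prismCochain_coboundary_zero (u : Cochain 0 Z) :
    prismCochain h (coboundary 0 Z u) =
      cochainPullback 0 (atVertex h 0) u + cochainPullback 0 (atVertex h 1) u := by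
  funext s
  rw [prismCochain, ← d_onPrism, TupleCochain.prism_d_zero]
  change u (prismSimplex h s fun i => (0, i)) + u (prismSimplex h s fun i => (1, i)) = _
  rw [prismSimplex_const, prismSimplex_const]
  rfl

theorem prismCochain_coboundary (u : Cochain (n + 1) Z) :
    prismCochain h (coboundary (n + 1) Z u) = coboundary n X (prismCochain h u) +
      cochainPullback _ (atVertex h 0) u + cochainPullback _ (atVertex h 1) u := by
  funext s
  rw [prismCochain, ← d_onPrism, TupleCochain.prism_d]
  change _ + u (prismSimplex h s fun i => (0, i)) + u (prismSimplex h s fun i => (1, i)) = _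
  rw [prismSimplex_const, prismSimplex_const]
  refine congrArg₂ (· + ·) (congrArg₂ (· + ·) ?_ rfl) rfl
  refine Finset.sum_congr rfl fun i _ => ?_
  rw [prismCochain, onPrism_face, TupleCochain.prism_comap (fun i => ((0 : Fin 2), i))
    (fun i => (1, i)) (fun i => ((0 : Fin 2), i)) (fun i => (1, i)) i.succAbove
    (Prod.map id i.succAbove) rfl rfl]
  rfl

/-- A homotopy, reparametrized by the standard `1`-simplex. -/
noncomputable def simplexHomotopy {f g : C(X, Z)} (H : f.Homotopy g) :
    C(stdSimplex ℝ (Fin 2) × X, Z) :=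
  H.toContinuousMap.comp
    ((ContinuousMap.mk _ stdSimplexHomeomorphUnitInterval.continuous).prodMap (ContinuousMap.id X))

theorem simplexHomotopy_zero {f g : C(X, Z)} (H : f.Homotopy g) :
    atVertex (simplexHomotopy H) 0 = f := by
  ext x
  change H (stdSimplexHomeomorphUnitInterval (stdSimplex.vertex 0), x) = f x
  rw [← H.apply_zero x]
  rfl

theorem simplexHomotopy_one {f g : C(X, Z)} (H : f.Homotopy g) :
    atVertex (simplexHomotopy H) 1 = g := by
  ext x
  change H (stdSimplexHomeomorphUnitInterval (stdSimplex.vertex 1), x) = g x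
  rw [← H.apply_one x]
  rfl

end SingularZ2

/-! ### Integration along the fibre -/

namespace FreeZ2Space

open SingularZ2

variable {X : FreeZ2Space.{u}} {Y : FreeZ2Space.{v}}

theorem prismCochain_wordCochain [T2Space Y] {ε : Y → ZMod 2} (hε : IsSign ε)
    (H : C(stdSimplex ℝ (Fin 2) × X, Y)) (n : ℕ) (s : Simplex n X) :
    prismCochain (Y.proj.comp H) (wordCochain (fun _ => ε) (n + 1)) s =
      TupleCochain.prism (atVertex H 0) (atVertex H 1) (TupleCochain.word (fun _ => ε) (n + 1))
        fun i => s (stdSimplex.vertex i) := by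
  have e : onPrism (Y.proj.comp H) (wordCochain (fun _ => ε) (n + 1)) s =
      TupleCochain.comap (fun w : Fin 2 × Fin (n + 1) =>
        H (stdSimplex.vertex w.1, s (stdSimplex.vertex w.2)))
        (TupleCochain.word (fun _ => ε) (n + 1)) := by
    funext w
    refine (wordCochain_proj_comp (fun _ => hε) (prismSimplex H s w)).trans ?_
    change _ = TupleCochain.word _ _ _
    congr 1
    funext i
    change H (affine _ _, s (affine _ _)) = _
    rw [affine_vertex, affine_vertex]
    rfl
  rw [prismCochain, e, TupleCochain.prism_comap (atVertex H 0) (atVertex H 1)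
    (fun i => ((0 : Fin 2), i)) (fun i => (1, i)) (fun i => s (stdSimplex.vertex i))
    (fun w : Fin 2 × Fin (n + 1) => H (stdSimplex.vertex w.1, s (stdSimplex.vertex w.2))) rfl rfl]
  rfl

/-- If a map `P` that is constant on orbits is homotopic to a `ℤ/2`-map `Q : X → Y`, then
`w(Y)^(n+1) = 0` implies `w(X)^n = 0`. From a primitive `u` of the cochain that represents
`w(Y)^(n+1)`, the prism operator and the transfer produce a primitive of the sum of the classes
`(δa)^i ∪ w(X)^(n-i)`, where `a` is a function on `X/ℤ₂`; the terms with `i > 0` are coboundaries.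
-/
theorem wordCochain_mem_of_homotopy [T2Space X] [T2Space Y] {P Q : C(X, Y)} (H : P.Homotopy Q)
    (hP : ∀ x, P (X.τ x) = P x) (hQ : ∀ x, Q (X.τ x) = Y.τ (Q x)) {ε : Y → ZMod 2}
    (hε : IsSign ε) {n : ℕ}
    (hn : wordCochain (fun _ => ε) (n + 1) ∈ coboundaries (n + 1) Y.Orbits) :
    wordCochain (fun _ => ε ∘ Q) n ∈ coboundaries n X.Orbits := by
  obtain ⟨u, hu⟩ := hn
  set h := simplexHomotopy H with hh
  have h0 : atVertex h 0 = P := simplexHomotopy_zero H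
  have h1 : atVertex h 1 = Q := simplexHomotopy_one H
  have hb : IsSign (ε ∘ Q) := fun x => by
    simp only [Function.comp_apply, hQ, hε (Q x)]
  have haτ : (ε ∘ P) ∘ X.τ = ε ∘ P := funext fun x => congrArg ε (hP x)
  have hbτ : (ε ∘ Q) ∘ X.τ = fun x => (ε ∘ Q) x + 1 := funext hb
  -- the transfer of the prism operator, applied to the representative of `w(Y)^(n+1)`
  have hsum : ∀ s : Simplex n X,
      prismCochain (Y.proj.comp h) (wordCochain (fun _ => ε) (n + 1)) s +
        prismCochain (Y.proj.comp h) (wordCochain (fun _ => ε) (n + 1)) (X.τ.comp s) =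
      ofTuple (TupleCochain.wordSum (ε ∘ P) (ε ∘ Q) n) s := by
    intro s
    rw [prismCochain_wordCochain hε, prismCochain_wordCochain hε, h0, h1]
    have := congrFun (TupleCochain.prism_word_add P Q ε (P ∘ X.τ) (Q ∘ X.τ)
      (fun x => congrFun haτ x) hb n) fun i => s (stdSimplex.vertex i)
    refine Eq.trans ?_ this
    rw [Pi.add_apply]
    congr 1
    exact (congrFun (TupleCochain.prism_comap P Q (P ∘ X.τ) (Q ∘ X.τ) X.τ id rfl rfl
      (TupleCochain.word (fun _ => ε) (n + 1))) fun i => s (stdSimplex.vertex i)).symm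
  -- the contributions of the ends of the homotopy are invariant, so that the transfer kills them
  have hP' : ∀ {m} (w : Cochain m Y.Orbits) (s : Simplex m X),
      cochainPullback m (atVertex (Y.proj.comp h) 0) w (X.τ.comp s) =
        cochainPullback m (atVertex (Y.proj.comp h) 0) w s := by
    intro m w s
    change w (Y.proj.comp ((atVertex h 0).comp (X.τ.comp s))) =
      w (Y.proj.comp ((atVertex h 0).comp s))
    rw [h0]
    congr 2
    ext x
    exact hP _
  have hQ' : ∀ {m} (w : Cochain m Y.Orbits) (s : Simplex m X),
      cochainPullback m (atVertex (Y.proj.comp h) 1) w (X.τ.comp s) =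
        cochainPullback m (atVertex (Y.proj.comp h) 1) w s := by
    intro m w s
    change w (Y.proj.comp ((atVertex h 1).comp (X.τ.comp s))) =
      w (Y.proj.comp ((atVertex h 1).comp s))
    rw [h1]
    congr 1
    ext x
    exact (congrArg Y.proj (hQ _)).trans (Y.proj_τ _)
  cases n with
  | zero =>
    rw [mem_coboundaries_zero_iff]
    funext σ
    -- in degree `0` the sum is `1`, so there can be no simplex at all
    exfalso
    have e := hsum (lift σ)
    rw [← hu, prismCochain_coboundary_zero] at e
    simp only [Pi.add_apply, hP', hQ'] at e
    rw [CharTwo.add_self_eq_zero] at e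
    exact zero_ne_one e
  | succ n =>
    set θ := prismCochain (Y.proj.comp h) u with hθ
    let θ' : Cochain n X := fun s => θ s + θ (X.τ.comp s)
    have hθ' : Invariant θ' := fun s => by
      change θ _ + θ (X.τ.comp (X.τ.comp s)) = θ _ + θ _
      have : X.τ.comp (X.τ.comp s) = s := ContinuousMap.ext fun x => X.involutive _
      rw [this, add_comm]
    let κ : TupleCochain n X :=
      TupleCochain.cupZero (ε ∘ P) (TupleCochain.wordSum (ε ∘ P) (ε ∘ Q) n)
    have hκ : Invariant (ofTuple κ) := by
      refine invariant_ofTuple (funext fun v => ?_)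
      have := congrFun (TupleCochain.comap_wordSum X.τ (ε ∘ P) (ε ∘ Q) n) v
      rw [haτ, hbτ, TupleCochain.wordSum_add_one] at this
      have h2 := congrFun haτ (v 0)
      change (ε ∘ P) (X.τ (v 0)) * _ = (ε ∘ P) (v 0) * _
      rw [← this, ← h2]
      rfl
    refine ⟨descend θ' + descend (ofTuple κ), ?_⟩
    rw [map_add, coboundary_descend hθ', coboundary_descend hκ]
    refine eq_of_forall_proj_comp fun s => ?_
    rw [wordCochain_proj_comp (fun _ => hb), Pi.add_apply, descend_proj_comp hθ'.coboundary,
      descend_proj_comp hκ.coboundary, coboundary_ofTuple]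
    have e1 : coboundary n X θ' s = coboundary n X θ s + coboundary n X θ (X.τ.comp s) :=
      Finset.sum_add_distrib (s := Finset.univ) (f := fun i : Fin (n + 2) => θ (face i s))
        (g := fun i => θ (X.τ.comp (face i s)))
    have e2 := hsum s
    rw [← hu, prismCochain_coboundary] at e2
    simp only [Pi.add_apply, hP', hQ'] at e2
    have e3 := congrFun (TupleCochain.wordSum_succ (ε ∘ P) (ε ∘ Q) n)
      fun i => s (stdSimplex.vertex i)
    rw [Pi.add_apply] at e3
    have e4 : coboundary n X θ s + coboundary n X θ (X.τ.comp s) =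
        ofTuple (TupleCochain.wordSum (ε ∘ P) (ε ∘ Q) (n + 1)) s := by
      rw [← e2]
      linear_combination -(cochainPullback (n + 1) (atVertex (Y.proj.comp h) 0) u s +
        cochainPullback (n + 1) (atVertex (Y.proj.comp h) 1) u s) *
          CharTwo.two_eq_zero (R := ZMod 2)
    rw [e1, e4]
    change TupleCochain.wordSum _ _ _ _ + TupleCochain.d κ _ = _
    rw [e3]
    change _ + TupleCochain.d κ _ + TupleCochain.d κ _ = _
    rw [add_assoc, CharTwo.add_self_eq_zero, add_zero]

end FreeZ2Space

/-! ### Contractibility of the infinite sphere -/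

namespace InfiniteSphere

open unitInterval

theorem continuous_incl (n : ℕ) : Continuous (incl n) :=
  continuous_iSup_rng (i := n) continuous_coinduced_rng

theorem continuous_coe : Continuous fun x : InfiniteSphere => x.1 :=
  continuous_iSup_dom.2 fun _ => continuous_coinduced_dom.2 continuous_subtype_val

instance : T2Space InfiniteSphere := T2Space.of_injective_continuous
  (f := fun x : InfiniteSphere => x.1) Subtype.val_injective continuous_coe

/-- Continuity on `I × S^∞` may be checked on the subspaces `I × Sⁿ`, since `I` is locally compact.
-/
theorem continuous_of_incl {Z : Type*} [TopologicalSpace Z] (F : I × InfiniteSphere → Z)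
    (h : ∀ n, Continuous fun p : I × finiteSphere n => F (p.1, incl n p.2)) : Continuous F := by
  have h1 : ∀ x, Continuous fun t => F (t, x) := by
    rintro ⟨x, n, hx⟩
    exact (h n).comp (f := fun t => (t, (⟨x, hx⟩ : finiteSphere n))) (by fun_prop)
  let G : InfiniteSphere → C(I, Z) := fun x => ⟨_, h1 x⟩
  have hG : Continuous G := by
    refine continuous_iSup_dom.2 fun n => continuous_coinduced_dom.2 ?_
    exact (ContinuousMap.curry ⟨fun p : finiteSphere n × I => F (p.2, incl n p.1),
      (h n).comp continuous_swap⟩).continuous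
  have : F = fun p => (G p.2) p.1 := rfl
  rw [this]
  exact (hG.comp continuous_snd).eval continuous_fst

theorem tsum_sq_eq {y : ℕ → ℝ} {m : ℕ} (hm : ∀ i, m < i → y i = 0) :
    ∑' j, y j ^ 2 = ∑ i ∈ Finset.range (m + 1), y i ^ 2 :=
  tsum_eq_sum fun i hi => by rw [hm i (by simpa using hi), zero_pow two_ne_zero]

/-- The point of `S^∞` in the direction of a nonzero vector with finitely many nonzero coordinates.
-/
noncomputable def normalize (y : ℕ → ℝ) (hy : ∃ m, ∀ i, m < i → y i = 0) (h0 : y ≠ 0) :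
    InfiniteSphere :=
  ⟨fun i => y i / √(∑' j, y j ^ 2), by
    obtain ⟨m, hm⟩ := hy
    refine ⟨m, fun i hi => by simp only [hm i hi, zero_div], ?_⟩
    have hs := tsum_sq_eq hm
    have hpos : 0 < ∑ i ∈ Finset.range (m + 1), y i ^ 2 := by
      obtain ⟨i, hi⟩ := Function.ne_iff.1 h0
      refine Finset.sum_pos' (fun _ _ => sq_nonneg _) ⟨i, ?_, sq_pos_of_ne_zero hi⟩
      rw [Finset.mem_range]
      by_contra hlt
      exact hi (hm i (by omega))
    simp only [div_pow, Real.sq_sqrt (hs ▸ hpos.le : 0 ≤ ∑' j, y j ^ 2)]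
    rw [← Finset.sum_div, hs, div_self hpos.ne']⟩

theorem ne_zero (x : InfiniteSphere) : x.1 ≠ 0 := by
  intro h
  obtain ⟨n, hn⟩ := x.2
  have := hn.2
  simp [h] at this

theorem normalize_coe (x : InfiniteSphere) (hx : ∃ m, ∀ i, m < i → x.1 i = 0) (h0 : x.1 ≠ 0) :
    normalize x.1 hx h0 = x := by
  apply Subtype.ext
  obtain ⟨n, hn⟩ := x.2
  have hs : ∑' j, x.1 j ^ 2 = 1 := (tsum_sq_eq hn.1).trans hn.2
  funext i
  simp [normalize, hs]

theorem continuous_normalize {A : Type*} [TopologicalSpace A] (φ : A → ℕ → ℝ)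
    (hφ : Continuous φ) (hf : ∀ a, ∃ m, ∀ i, m < i → φ a i = 0) (h0 : ∀ a, φ a ≠ 0)
    (m : ℕ) (hm : ∀ a i, m < i → φ a i = 0) :
    Continuous fun a => normalize (φ a) (hf a) (h0 a) := by
  have hs : ∀ a, ∑' j, φ a j ^ 2 = ∑ i ∈ Finset.range (m + 1), φ a i ^ 2 := fun a =>
    tsum_sq_eq (hm a)
  have hmem : ∀ a, (normalize (φ a) (hf a) (h0 a)).1 ∈ finiteSphere m := by
    intro a
    have hz : ∀ i, m < i → (normalize (φ a) (hf a) (h0 a)).1 i = 0 := fun i hi => by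
      simp [normalize, hm a i hi]
    refine ⟨hz, ?_⟩
    obtain ⟨n, hn⟩ := (normalize (φ a) (hf a) (h0 a)).2
    rw [← hn.2, ← tsum_sq_eq hz, ← tsum_sq_eq hn.1]
  have hc : Continuous fun a => (⟨_, hmem a⟩ : finiteSphere m) := by
    refine Continuous.subtype_mk (continuous_pi fun i => ?_) _
    have h1 : ∀ i, Continuous fun a => φ a i := fun i => (continuous_apply i).comp hφ
    change Continuous fun a => φ a i / √(∑' j, φ a j ^ 2)
    simp only [hs]
    refine (h1 i).div (Real.continuous_sqrt.comp
      (continuous_finsetSum _ fun j _ => (h1 j).pow 2)) fun a h => ?_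
    refine ne_zero (normalize (φ a) (hf a) (h0 a)) (funext fun j => ?_)
    change φ a j / √(∑' j, φ a j ^ 2) = 0
    rw [hs, h, div_zero]
  exact (continuous_incl m).comp hc

/-- The shift `(x₀, x₁, …) ↦ (0, x₀, x₁, …)`. -/
def shift (x : ℕ → ℝ) : ℕ → ℝ
  | 0 => 0
  | i + 1 => x i

theorem continuous_shift : Continuous shift :=
  continuous_pi fun i => match i with
    | 0 => continuous_const
    | i + 1 => continuous_apply i

theorem shift_eq_zero {x : ℕ → ℝ} {m : ℕ} (hx : ∀ i, m < i → x i = 0) :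
    ∀ i, m + 1 < i → shift x i = 0
  | 0, h => rfl
  | i + 1, h => hx i (by omega)

theorem exists_bound (x : InfiniteSphere) : ∃ m, ∀ i, m < i → x.1 i = 0 :=
  x.2.imp fun _ h => h.1

theorem shift_ne_zero {x : ℕ → ℝ} (hx : x ≠ 0) : shift x ≠ 0 := fun h =>
  hx (funext fun i => congrFun h (i + 1))

theorem line_shift_ne_zero {x : ℕ → ℝ} (hx : x ≠ 0) (t : ℝ) : (1 - t) • x + t • shift x ≠ 0 := by
  intro h
  have hi : ∀ i, (1 - t) * x i + t * shift x i = 0 := fun i => congrFun h i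
  apply hx
  by_cases ht : 1 - t = 0
  · have ht1 : t = 1 := by linarith
    funext i
    have := hi (i + 1)
    simpa [ht1, shift] using this
  · funext i
    induction i with
    | zero => simpa [shift, ht] using hi 0
    | succ i ih =>
      have := hi (i + 1)
      rw [shift, ih] at this
      simpa [ht] using this

theorem line_single_ne_zero {x : ℕ → ℝ} (hx : x ≠ 0) (t : ℝ) :
    (1 - t) • shift x + t • (Pi.single 0 1 : ℕ → ℝ) ≠ 0 := by
  intro h
  have h0 : t = 0 := by simpa [shift] using congrFun h 0
  subst h0
  exact shift_ne_zero hx (by simpa using h)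

/-- The identity is homotopic to the shift, and the shift to a constant map, along straight lines
that avoid the origin. -/
theorem contractible : ∃ c : InfiniteSphere,
    (ContinuousMap.id InfiniteSphere).Homotopic (ContinuousMap.const _ c) := by
  have b1 : ∀ (n : ℕ) (t : ℝ) (x : ℕ → ℝ), (∀ i, n < i → x i = 0) →
      ∀ i, n + 1 < i → ((1 - t) • x + t • shift x) i = 0 := by
    intro n t x hx i hi
    simp [hx i (by omega), shift_eq_zero hx i hi]
  have b2 : ∀ (n : ℕ) (t : ℝ) (x : ℕ → ℝ), (∀ i, n < i → x i = 0) →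
      ∀ i, n + 1 < i → ((1 - t) • shift x + t • (Pi.single 0 1 : ℕ → ℝ)) i = 0 := by
    intro n t x hx i hi
    have : i ≠ 0 := by omega
    simp [shift_eq_zero hx i hi, this]
  let F : I × InfiniteSphere → InfiniteSphere := fun p =>
    normalize ((1 - p.1.1) • p.2.1 + p.1.1 • shift p.2.1)
      ((exists_bound p.2).elim fun n hn => ⟨n + 1, b1 n _ _ hn⟩) (line_shift_ne_zero p.2.ne_zero _)
  let F' : I × InfiniteSphere → InfiniteSphere := fun p =>
    normalize ((1 - p.1.1) • shift p.2.1 + p.1.1 • (Pi.single 0 1 : ℕ → ℝ))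
      ((exists_bound p.2).elim fun n hn => ⟨n + 1, b2 n _ _ hn⟩) (line_single_ne_zero p.2.ne_zero _)
  have hF : Continuous F := continuous_of_incl _ fun n =>
    continuous_normalize (fun p : I × finiteSphere n =>
      (1 - p.1.1) • p.2.1 + p.1.1 • shift p.2.1)
      (by have := continuous_shift; fun_prop) _ _ (n + 1) fun p => b1 n _ _ p.2.2.1
  have hF' : Continuous F' := continuous_of_incl _ fun n =>
    continuous_normalize (fun p : I × finiteSphere n =>
      (1 - p.1.1) • shift p.2.1 + p.1.1 • (Pi.single 0 1 : ℕ → ℝ))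
      (by have := continuous_shift; fun_prop) _ _ (n + 1) fun p => b2 n _ _ p.2.2.1
  have hcongr : ∀ (y z : ℕ → ℝ) hy hy0 hz hz0, y = z → normalize y hy hy0 = normalize z hz hz0 := by
    rintro y z _ _ _ _ rfl; rfl
  let S : C(InfiniteSphere, InfiniteSphere) := ⟨fun x => F (1, x), by fun_prop⟩
  have s0 : (Pi.single 0 1 : ℕ → ℝ) ≠ 0 := fun h => by simpa using congrFun h 0
  have sb : ∃ m, ∀ i, m < i → (Pi.single 0 1 : ℕ → ℝ) i = 0 :=
    ⟨0, fun i hi => by simp [hi.ne']⟩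
  refine ⟨normalize (Pi.single 0 1) sb s0, ?_⟩
  have H1 : (ContinuousMap.id InfiniteSphere).Homotopic S :=
    ⟨{ toContinuousMap := ⟨F, hF⟩
       map_zero_left := fun x => by
         refine Eq.trans ?_ (normalize_coe x (exists_bound x) x.ne_zero)
         apply hcongr
         simp
       map_one_left := fun x => rfl }⟩
  refine H1.trans ⟨{ toContinuousMap := ⟨F', hF'⟩
                     map_zero_left := fun x => by
                       change F' (0, x) = F (1, x)
                       simp only [F, F']
                       congr 1
                       simp
                     map_one_left := fun x => by
                       change F' (1, x) = normalize _ sb s0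
                       simp only [F']
                       congr 1
                       simp }⟩

instance : ContractibleSpace InfiniteSphere :=
  (contractible_iff_id_nullhomotopic _).2 contractible

end InfiniteSphere

/-! ### The cohomological index in terms of sign functions -/

namespace SingularZ2

/-- `H¹(Z; ℤ/2) = 0` for contractible `Z`. -/
theorem exists_eq_add_of_contractible {Z : Type u} [TopologicalSpace Z] [ContractibleSpace Z]
    (γ : cocycles 1 Z) :
    ∃ h : Z → ZMod 2, ∀ s : Simplex 1 Z,
      γ.1 s = h (s (stdSimplex.vertex 0)) + h (s (stdSimplex.vertex 1)) := by
  obtain ⟨c, ⟨H⟩⟩ := id_nullhomotopic Z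
  have hγ : coboundary 1 Z γ.1 = 0 := γ.2
  have e := prismCochain_coboundary (simplexHomotopy H) γ.1
  have e0 : prismCochain (simplexHomotopy H) (0 : Cochain (1 + 1) Z) = 0 := by
    funext s
    exact congrFun (TupleCochain.prism_zero _ _) _
  rw [hγ, e0, simplexHomotopy_zero, simplexHomotopy_one] at e
  set ψ := prismCochain (simplexHomotopy H) γ.1
  have hc : ∀ s : Simplex 1 Z, γ.1 ((ContinuousMap.const Z c).comp s) = 0 := by
    intro s
    have h1 := congrFun hγ (ContinuousMap.const _ c)
    change ∑ i : Fin 3, γ.1 (ContinuousMap.const _ c) = 0 at h1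
    rw [Fin.sum_univ_three, CharTwo.add_self_eq_zero, zero_add] at h1
    exact h1
  have hf : ∀ (s : Simplex 1 Z) (i : Fin 2),
      face i s = ContinuousMap.const _ (s (stdSimplex.vertex (i.succAbove 0))) := by
    intro s i
    ext1 x
    rw [Subsingleton.elim x (stdSimplex.vertex 0), face_vertex]
    rfl
  refine ⟨fun z => ψ (ContinuousMap.const _ z), fun s => ?_⟩
  have e1 := congrFun e s
  change 0 = (∑ i : Fin 2, ψ (face i s)) + γ.1 s +
    γ.1 ((ContinuousMap.const Z c).comp s) at e1
  rw [hc, add_zero, Fin.sum_univ_two, hf, hf] at e1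
  change 0 = ψ (ContinuousMap.const _ (s (stdSimplex.vertex 1))) +
    ψ (ContinuousMap.const _ (s (stdSimplex.vertex 0))) + γ.1 s at e1
  linear_combination e1 + γ.1 s * CharTwo.two_eq_zero (R := ZMod 2)

/-- A path as a singular `1`-simplex. -/
noncomputable def pathSimplex {Z : Type u} [TopologicalSpace Z] {x y : Z} (p : Path x y) :
    Simplex 1 Z :=
  p.toContinuousMap.comp ⟨_, stdSimplexHomeomorphUnitInterval.continuous⟩

theorem pathSimplex_zero {Z : Type u} [TopologicalSpace Z] {x y : Z} (p : Path x y) :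
    pathSimplex p (stdSimplex.vertex 0) = x := p.source

theorem pathSimplex_one {Z : Type u} [TopologicalSpace Z] {x y : Z} (p : Path x y) :
    pathSimplex p (stdSimplex.vertex 1) = y := p.target

theorem eq_of_forall_simplex {Z : Type u} [TopologicalSpace Z] [PathConnectedSpace Z]
    {h : Z → ZMod 2}
    (hh : ∀ s : Simplex 1 Z, h (s (stdSimplex.vertex 0)) = h (s (stdSimplex.vertex 1)))
    (x y : Z) : h x = h y := by
  have := hh (pathSimplex (PathConnectedSpace.somePath x y))
  rwa [pathSimplex_zero, pathSimplex_one] at this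

end SingularZ2

namespace FreeZ2Space

open SingularZ2

instance : T2Space sphereInfty := inferInstanceAs (T2Space InfiniteSphere)
instance : ContractibleSpace sphereInfty := inferInstanceAs (ContractibleSpace InfiniteSphere)

variable {X : FreeZ2Space.{u}}

/-- On `S^∞` the cocycle `γ` becomes the coboundary of a function `h`. As `h + h ∘ τ` is constant,
either `h` is invariant and `γ` is a coboundary on `ℝP^∞`, or `h` is a sign function. -/
theorem exists_isSign_of_cls_ne_zero (γ : cocycles 1 RPInfty) (hγ : cls γ ≠ 0) :
    ∃ ε : sphereInfty → ZMod 2, IsSign ε ∧ ∀ s : Simplex 1 sphereInfty,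
      γ.1 (sphereInfty.proj.comp s) =
        ε (s (stdSimplex.vertex 0)) + ε (s (stdSimplex.vertex 1)) := by
  obtain ⟨h, hh⟩ := exists_eq_add_of_contractible (cocyclesPullback 1 sphereInfty.proj γ)
  change ∀ s : Simplex 1 sphereInfty, γ.1 (sphereInfty.proj.comp s) = _ at hh
  refine ⟨h, ?_, hh⟩
  have hconst := eq_of_forall_simplex (h := fun x => h x + h (sphereInfty.τ x)) (by
    intro s
    have h1 := hh (sphereInfty.τ.comp s)
    rw [← ContinuousMap.comp_assoc, proj_comp_τ, hh s] at h1
    simp only [ContinuousMap.comp_apply] at h1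
    linear_combination h1 + (h (sphereInfty.τ (s (stdSimplex.vertex 0))) -
      h (s (stdSimplex.vertex 1))) * CharTwo.two_eq_zero (R := ZMod 2))
  intro x
  by_contra hx
  have hx0 : h x + h (sphereInfty.τ x) = 0 := by
    revert hx
    generalize h x = a
    generalize h (sphereInfty.τ x) = b
    revert a b
    decide
  refine hγ ((cls_eq_zero_iff _).2 ?_)
  have hinv : ∀ y, h (sphereInfty.τ y) = h y := fun y =>
    (CharTwo.add_eq_zero.1 ((hconst y x).trans hx0)).symm
  let φ : TupleCochain 0 sphereInfty := fun v => h (v 0)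
  have hφ : Invariant (ofTuple φ) := invariant_ofTuple (funext fun v => hinv _)
  refine ⟨descend (ofTuple φ), eq_of_forall_proj_comp fun s => ?_⟩
  rw [coboundary_descend hφ, descend_proj_comp hφ.coboundary, hh, coboundary_ofTuple]
  rw [ofTuple, TupleCochain.d, Fin.sum_univ_two, add_comm]
  rfl

/-- `H¹(ℝP^∞; ℤ/2)` is not zero. -/
theorem cls_wordCochain_ne_zero {ε : sphereInfty → ZMod 2} (hε : IsSign ε) :
    cls ⟨wordCochain (fun _ => ε) 1, wordCochain_mem_cocycles (fun _ => hε) 1⟩ ≠ 0 := by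
  intro h0
  rw [cls_eq_zero_iff] at h0
  obtain ⟨ψ, hψ⟩ := h0
  -- along paths `ε` would agree, up to a constant, with a function that is invariant
  let g : sphereInfty → ZMod 2 := fun x => ε x + ψ (ContinuousMap.const _ (sphereInfty.proj x))
  have hg : ∀ s : Simplex 1 sphereInfty,
      g (s (stdSimplex.vertex 0)) = g (s (stdSimplex.vertex 1)) := by
    intro s
    have h1 := congrFun hψ (sphereInfty.proj.comp s)
    change ∑ i : Fin 2, ψ (face i (sphereInfty.proj.comp s)) =
      wordCochain (fun _ => ε) 1 (sphereInfty.proj.comp s) at h1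
    have hf : ∀ i : Fin 2, face i (sphereInfty.proj.comp s) =
        ContinuousMap.const _ (sphereInfty.proj (s (stdSimplex.vertex (i.succAbove 0)))) := by
      intro i
      ext1 x
      rw [Subsingleton.elim x (stdSimplex.vertex 0), face_vertex]
      rfl
    rw [wordCochain_proj_comp (fun _ => hε), TupleCochain.word_eq_prod, Fin.sum_univ_two, hf, hf,
      Fin.prod_univ_one] at h1
    change ψ (ContinuousMap.const _ (sphereInfty.proj (s (stdSimplex.vertex 1)))) +
      ψ (ContinuousMap.const _ (sphereInfty.proj (s (stdSimplex.vertex 0)))) =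
      ε (s (stdSimplex.vertex 0)) + ε (s (stdSimplex.vertex 1)) at h1
    change ε _ + ψ _ = ε _ + ψ _
    generalize ψ (ContinuousMap.const _ (sphereInfty.proj (s (stdSimplex.vertex 0)))) = a at *
    generalize ψ (ContinuousMap.const _ (sphereInfty.proj (s (stdSimplex.vertex 1)))) = b at *
    generalize ε (s (stdSimplex.vertex 0)) = c at *
    generalize ε (s (stdSimplex.vertex 1)) = d at *
    revert a b c d
    decide
  obtain ⟨x⟩ := (inferInstance : Nonempty sphereInfty)
  have h2 := eq_of_forall_simplex hg x (sphereInfty.τ x)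
  simp only [g, proj_τ, hε x] at h2
  have h3 := add_right_cancel h2
  generalize ε x = a at h3
  revert a
  decide

theorem pullback_cupPow_eq_zero_iff [T2Space X] (f : X.EquivariantMap sphereInfty)
    {ε : sphereInfty → ZMod 2} (hε : IsSign ε) (γ : cocycles 1 RPInfty)
    (hγ : ∀ s : Simplex 1 sphereInfty, γ.1 (sphereInfty.proj.comp s) =
        ε (s (stdSimplex.vertex 0)) + ε (s (stdSimplex.vertex 1))) (k : ℕ) :
    pullback k f.onOrbits (cupPow γ k) = 0 ↔
      wordCochain (fun _ => ε ∘ f.toMap) k ∈ coboundaries k X.Orbits := by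
  have hε' : IsSign (ε ∘ f.toMap) := fun x => by
    simp only [Function.comp_apply, f.equivariant, hε (f.toMap x)]
  change cls (cocyclesPullback k f.onOrbits ⟨cupPowCochain γ.1 k, _⟩) = 0 ↔ _
  rw [cls_eq_zero_iff]
  change cochainPullback k f.onOrbits (cupPowCochain γ.1 k) ∈ _ ↔ _
  have : cochainPullback k f.onOrbits (cupPowCochain γ.1 k) =
      wordCochain (fun _ => ε ∘ f.toMap) k := by
    refine eq_of_forall_proj_comp fun s => ?_
    rw [wordCochain_proj_comp (fun _ => hε'), TupleCochain.word_eq_prod]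
    change ∏ i : Fin k, γ.1 (edge i.castSucc i.succ (f.onOrbits.comp (X.proj.comp s))) = _
    refine Finset.prod_congr rfl fun i _ => ?_
    refine (hγ ((f.toMap.comp s).comp (affine ![i.castSucc, i.succ]))).trans ?_
    simp only [ContinuousMap.comp_apply, affine_vertex]
    rfl
  rw [this]

theorem not_mem_of_pullback_ne_zero [T2Space X] {k : ℕ} (f : X.EquivariantMap sphereInfty)
    (γ : cocycles 1 RPInfty) (hγ : cls γ ≠ 0)
    (h : pullback k f.onOrbits (cupPow γ k) ≠ 0) {ε : X → ZMod 2} (hε : IsSign ε) :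
    wordCochain (fun _ => ε) k ∉ coboundaries k X.Orbits := by
  obtain ⟨δ, hδ, hγδ⟩ := exists_isSign_of_cls_ne_zero γ hγ
  intro hmem
  refine h ((pullback_cupPow_eq_zero_iff f hδ γ hγδ k).2 ?_)
  refine wordCochain_mem_of_mem (fun _ => hε) (fun _ x => ?_) hmem
  simp only [Function.comp_apply, f.equivariant, hδ (f.toMap x)]

theorem exists_pullback_ne_zero [T2Space X] {k : ℕ} (f : X.EquivariantMap sphereInfty)
    {ε : X → ZMod 2} (hε : IsSign ε)
    (h : wordCochain (fun _ => ε) k ∉ coboundaries k X.Orbits) :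
    ∃ γ : cocycles 1 RPInfty, cls γ ≠ 0 ∧ pullback k f.onOrbits (cupPow γ k) ≠ 0 := by
  obtain ⟨δ, hδ⟩ := exists_isSign sphereInfty
  refine ⟨_, cls_wordCochain_ne_zero hδ, fun h0 => h ?_⟩
  rw [pullback_cupPow_eq_zero_iff f hδ] at h0
  · refine wordCochain_mem_of_mem (fun _ x => ?_) (fun _ => hε) h0
    simp only [Function.comp_apply, f.equivariant, hδ (f.toMap x)]
  · intro s
    refine (wordCochain_proj_comp (fun _ => hδ) s).trans ?_
    rw [TupleCochain.word_eq_prod, Fin.prod_univ_one]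
    rfl

end FreeZ2Space

/-! ### Upper bounds for the index -/

namespace FreeZ2Space

open SingularZ2

variable {X : FreeZ2Space.{u}}

/-- If `X` has `k` odd functions without common zero, that is, a `ℤ/2`-map to `S^(k-1)`, then the
`k`-th power of the class of the double covering vanishes. -/
theorem wordCochain_mem_of_odd [T2Space X] {k : ℕ} (hk : 1 ≤ k) (f : ℕ → C(X, ℝ))
    (hodd : ∀ i x, f i (X.τ x) = -f i x) (hcov : ∀ x, ∃ i < k, f i x ≠ 0)
    {ε : X → ZMod 2} (hε : IsSign ε) : wordCochain (fun _ => ε) k ∈ coboundaries k X.Orbits := by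
  -- the sign of `f i`, completed to a sign function on the zeros of `f i`
  let a : ℕ → X → ZMod 2 := fun i x => if 0 < f i x then 0 else if f i x < 0 then 1 else ε x
  have ha : ∀ i, IsSign (a i) := by
    intro i x
    simp only [a, hodd, Left.neg_pos_iff, Left.neg_neg_iff]
    rcases lt_trichotomy (f i x) 0 with h | h | h
    · rw [if_pos h, if_neg h.not_gt, if_pos h]
      decide
    · simp [h, hε x]
    · simp [h, h.le]
  refine wordCochain_mem_of_mem ha (fun _ => hε) ?_
  obtain ⟨n, rfl⟩ : ∃ n, k = n + 1 := ⟨k - 1, by omega⟩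
  have hpre : ∀ i x, X.proj x ∈ X.proj '' {y | f i y ≠ 0} ↔ f i x ≠ 0 := by
    intro i x
    refine ⟨?_, fun h => ⟨x, h, rfl⟩⟩
    rintro ⟨y, hy, hyx⟩
    rcases X.proj_eq_iff.1 hyx with rfl | rfl
    · exact hy
    · simpa [hodd] using hy
  refine mem_coboundaries_of_small (fun i : Fin (n + 1) => X.proj '' {y | f i y ≠ 0})
    (fun i => ?_) (fun x => ?_) _ (fun σ i hσ => ?_) (wordCochain_mem_cocycles ha _)
  · have hq : Topology.IsQuotientMap X.proj := isQuotientMap_quot_mk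
    rw [← hq.isOpen_preimage]
    have : X.proj ⁻¹' (X.proj '' {y | f i y ≠ 0}) = {y | f i y ≠ 0} := Set.ext (hpre i)
    rw [this]
    exact isOpen_ne_fun (f i).continuous continuous_const
  · obtain ⟨x, rfl⟩ := Quot.exists_rep x
    obtain ⟨i, hi, hx⟩ := hcov x
    exact ⟨⟨i, hi⟩, x, hx, rfl⟩
  · rw [← proj_comp_lift σ] at hσ ⊢
    set s := lift σ
    rw [wordCochain_proj_comp ha, TupleCochain.word_eq_prod]
    refine Finset.prod_eq_zero (Finset.mem_univ i) ?_
    have hne : ∀ x, f i (s x) ≠ 0 := fun x => (hpre i _).1 (hσ x)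
    have hsign : ∀ x y, 0 < f i (s x) → 0 < f i (s y) := by
      intro x y hx
      by_contra hy
      obtain ⟨z, hz⟩ := mem_range_of_exists_le_of_exists_ge ((f i).comp s).continuous
        ⟨y, not_lt.1 hy⟩ ⟨x, hx.le⟩
      exact hne z hz
    have heq : ∀ x y, a i (s x) = a i (s y) := by
      intro x y
      by_cases hx : 0 < f i (s x)
      · simp only [a, if_pos hx, if_pos (hsign x y hx)]
      · have hy : ¬ 0 < f i (s y) := fun h => hx (hsign y x h)
        simp only [a, if_neg hx, if_neg hy, if_pos (lt_of_le_of_ne (not_lt.1 hx) (hne x)),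
          if_pos (lt_of_le_of_ne (not_lt.1 hy) (hne y))]
    rw [heq _ (stdSimplex.vertex i.succ)]
    exact CharTwo.add_self_eq_zero _

end FreeZ2Space

/-! ### The complex `Hom(K₂, G)` -/

section HomComplex

open FreeZ2Space SingularZ2

variable {V : Type v} {W : Type w}

instance [Fintype W] (T : SimpleGraph V) (G : SimpleGraph W) : T2Space (HomComplex T G) :=
  inferInstanceAs (T2Space {x : V → stdSimplex ℝ W // IsMultiHom T G fun v => {a | x v a ≠ 0}})

theorem HomComplex.continuous_apply [Fintype W] (T : SimpleGraph V) (G : SimpleGraph W) (v : V) :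
    Continuous fun x : HomComplex T G => x.1 v :=
  (_root_.continuous_apply v).comp continuous_subtype_val

instance [Fintype W] (G : SimpleGraph W) : T2Space (homK2 G) :=
  inferInstanceAs (T2Space (HomComplex (⊤ : SimpleGraph (Fin 2)) G))

instance [Fintype W] (r : ℕ) (hr : 1 ≤ r) (G : SimpleGraph W) : T2Space (homOddCycle r hr G) :=
  inferInstanceAs (T2Space (HomComplex (SimpleGraph.cycleGraph (2 * r + 1)) G))

theorem IsMultiHom.adj {T : SimpleGraph V} {G : SimpleGraph W} {φ : V → Set W}
    (h : IsMultiHom T G φ) {u v : V} (huv : T.Adj u v) {a b : W} (ha : a ∈ φ u) (hb : b ∈ φ v) :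
    G.Adj a b := by
  classical
  choose g hg using h.1
  have := h.2 (Function.update (Function.update g v b) u a) (fun z => by
    by_cases hz : z = u
    · subst hz; simpa using ha
    · rw [Function.update_of_ne hz]
      by_cases hz' : z = v
      · subst hz'; simpa using hb
      · rw [Function.update_of_ne hz']; exact hg z) u v huv
  rwa [Function.update_self, Function.update_of_ne huv.ne', Function.update_self] at this

theorem stdSimplex.exists_ne_zero [Fintype W] (p : stdSimplex ℝ W) : ∃ a, p a ≠ 0 := by
  by_contra! h
  have := p.2.2
  have h0 : ∑ x, p.1 x = 0 := Finset.sum_eq_zero fun x _ => h x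
  exact zero_ne_one (h0.symm.trans this)

variable [Fintype W] {G : SimpleGraph W}

theorem homK2_adj (x : homK2 G) {a b : W} (ha : (x.1 0) a ≠ 0) (hb : (x.1 1) b ≠ 0) : G.Adj a b :=
  x.2.adj (u := 0) (v := 1) (by simp) ha hb

theorem homK2_continuous_apply (v : Fin 2) : Continuous fun x : homK2 G => x.1 v :=
  HomComplex.continuous_apply _ G v

theorem homK2_continuous_coord (v : Fin 2) (a : W) : Continuous fun x : homK2 G => (x.1 v).1 a :=
  (_root_.continuous_apply a).comp (continuous_subtype_val.comp (homK2_continuous_apply v))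

/-- Two adjacent vertices are distinct, so `x₀ - x₁` does not vanish on `Hom(K₂, G)`; its direction
is a `ℤ/2`-map to a sphere. -/
theorem nonempty_equivariantMap_homK2 (G : SimpleGraph W) :
    Nonempty ((homK2 G).EquivariantMap sphereInfty) := by
  let e := Fintype.equivFin W
  let φ : homK2 G → ℕ → ℝ := fun x i =>
    if h : i < Fintype.card W then (x.1 0).1 (e.symm ⟨i, h⟩) - (x.1 1).1 (e.symm ⟨i, h⟩) else 0
  have hφ : Continuous φ := continuous_pi fun i => by
    by_cases h : i < Fintype.card W
    · simp only [φ, dif_pos h]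
      exact (homK2_continuous_coord 0 _).sub (homK2_continuous_coord 1 _)
    · simp only [φ, dif_neg h]
      exact continuous_const
  have hb : ∀ x i, Fintype.card W < i → φ x i = 0 := fun x i hi => dif_neg (by omega)
  have h0 : ∀ x, φ x ≠ 0 := by
    intro x hx
    obtain ⟨a, ha⟩ := stdSimplex.exists_ne_zero (x.1 0)
    have h1 := congrFun hx (e a)
    have h2 : (x.1 0).1 a - (x.1 1).1 a = 0 := by simpa [φ] using h1
    by_cases hb : (x.1 1) a = 0
    · exact ha (by
        have h3 : (x.1 1).1 a = 0 := hb
        rw [h3, sub_zero] at h2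
        exact h2)
    · exact G.irrefl (homK2_adj x ha hb)
  refine ⟨⟨⟨_, InfiniteSphere.continuous_normalize φ hφ (fun x => ⟨_, hb x⟩) h0 _ hb⟩, ?_⟩⟩
  intro x
  have hneg : φ ((homK2 G).τ x) = -φ x := by
    funext i
    by_cases h : i < Fintype.card W
    · simp only [φ, dif_pos h, Pi.neg_apply, neg_sub]
      rfl
    · simp only [φ, dif_neg h, Pi.neg_apply, neg_zero]
  apply Subtype.ext
  funext i
  change φ ((homK2 G).τ x) i / √(∑' j, φ ((homK2 G).τ x) j ^ 2) =
    -(φ x i / √(∑' j, φ x j ^ 2))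
  rw [hneg]
  simp [neg_div]

theorem wordCochain_homK2_mem {k : ℕ} (hk : 1 ≤ k) (hG : G.Colorable (k + 1))
    {ε : homK2 G → ZMod 2} (hε : IsSign ε) :
    wordCochain (fun _ => ε) k ∈ coboundaries k (homK2 G).Orbits := by
  classical
  obtain ⟨C⟩ := hG
  let F (i : ℕ) (v : Fin 2) (x : homK2 G) : ℝ := ∑ a, if (C a : ℕ) = i then (x.1 v).1 a else 0
  have hF : ∀ i v, Continuous (F i v) := fun i v => continuous_finsetSum _ fun a _ => by
    split_ifs
    · exact homK2_continuous_coord v a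
    · exact continuous_const
  have hsum : ∀ v x, ∑ i ∈ Finset.range (k + 1), F i v x = 1 := by
    intro v x
    simp only [F]
    rw [Finset.sum_comm, ← (x.1 v).2.2]
    refine Finset.sum_congr rfl fun a _ => ?_
    rw [Finset.sum_ite_eq, if_pos (Finset.mem_range.2 (C a).2)]
  refine wordCochain_mem_of_odd hk (fun i => ⟨fun x => F i 0 x - F i 1 x, (hF i 0).sub (hF i 1)⟩)
    (fun i x => (neg_sub _ _).symm) (fun x => ?_) hε
  by_contra! hzero
  replace hzero : ∀ i < k, F i 0 x - F i 1 x = 0 := hzero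
  -- the sum of all the functions is zero, so the one for the last colour vanishes as well
  have hall : ∀ i < k + 1, F i 0 x - F i 1 x = 0 := by
    intro i hi
    obtain hi | rfl := Nat.lt_succ_iff_lt_or_eq.1 hi
    · exact hzero i hi
    · have h0 := hsum 0 x
      have h1 := hsum 1 x
      rw [Finset.sum_range_succ] at h0 h1
      have : ∑ j ∈ Finset.range i, F j 0 x = ∑ j ∈ Finset.range i, F j 1 x :=
        Finset.sum_congr rfl fun j hj => sub_eq_zero.1 (hzero j (Finset.mem_range.1 hj))
      linarith
  obtain ⟨a, ha⟩ := stdSimplex.exists_ne_zero (x.1 0)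
  have h1 : F (C a) 1 x = 0 := by
    refine Finset.sum_eq_zero fun b _ => ?_
    split_ifs with hb
    · by_contra hb'
      exact C.valid (homK2_adj x ha hb') (Fin.ext hb.symm)
    · rfl
  have h0 : 0 < F (C a) 0 x := by
    refine Finset.sum_pos' (fun b _ => ?_) ⟨a, Finset.mem_univ _, ?_⟩
    · split_ifs
      · exact (x.1 0).2.1 b
      · exact le_rfl
    · rw [if_pos rfl]
      exact lt_of_le_of_ne ((x.1 0).2.1 a) (Ne.symm ha)
  have := hall _ (C a).2
  linarith

end HomComplex

/-! ### A homotopy of maps from `Hom(C_{2r+1}, G)` to `Hom(K₂, G)` -/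

section Homotopy

open FreeZ2Space SingularZ2 unitInterval

variable {A : Type u} [TopologicalSpace A] {W : Type w} [Fintype W] {G : SimpleGraph W}

/-- The point `(1 - t) p + t q` of the segment from `p` to `q`. -/
def stdSimplex.mix (t : I) (p q : stdSimplex ℝ W) : stdSimplex ℝ W :=
  ⟨(1 - t.1) • p.1 + t.1 • q.1, convex_stdSimplex ℝ W p.2 q.2 (sub_nonneg.2 t.2.2) t.2.1
    (sub_add_cancel _ _)⟩

theorem stdSimplex.mix_zero (p q : stdSimplex ℝ W) : stdSimplex.mix 0 p q = p :=
  Subtype.ext (by simp [stdSimplex.mix])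

theorem stdSimplex.mix_one (p q : stdSimplex ℝ W) : stdSimplex.mix 1 p q = q :=
  Subtype.ext (by simp [stdSimplex.mix])

theorem stdSimplex.continuous_mix :
    Continuous fun x : I × stdSimplex ℝ W × stdSimplex ℝ W => stdSimplex.mix x.1 x.2.1 x.2.2 := by
  refine Continuous.subtype_mk ?_ _
  fun_prop

theorem stdSimplex.ne_zero_or_of_mix {t : I} {p q : stdSimplex ℝ W} {a : W}
    (h : stdSimplex.mix t p q a ≠ 0) : p a ≠ 0 ∨ q a ≠ 0 := by
  by_contra! h'
  apply h
  change (1 - t.1) * p a + t.1 * q a = 0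
  rw [h'.1, h'.2, mul_zero, mul_zero, add_zero]

/-- Every vertex in the support of `p` is adjacent to every vertex in the support of `q`, that is,
`(p, q)` is a point of `Hom(K₂, G)`. -/
def AdjSupport (G : SimpleGraph W) (p q : stdSimplex ℝ W) : Prop :=
  ∀ a b, p a ≠ 0 → q b ≠ 0 → G.Adj a b

theorem AdjSupport.symm {p q : stdSimplex ℝ W} (h : AdjSupport G p q) : AdjSupport G q p :=
  fun a b ha hb => (h b a hb ha).symm

theorem AdjSupport.mix_left {p p' q : stdSimplex ℝ W} (h : AdjSupport G p q)
    (h' : AdjSupport G p' q) (t : I) : AdjSupport G (stdSimplex.mix t p p') q :=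
  fun a b ha hb => (stdSimplex.ne_zero_or_of_mix ha).elim (fun e => h a b e hb)
    fun e => h' a b e hb

theorem AdjSupport.mix_right {p q q' : stdSimplex ℝ W} (h : AdjSupport G p q)
    (h' : AdjSupport G p q') (t : I) : AdjSupport G p (stdSimplex.mix t q q') :=
  (h.symm.mix_left h'.symm t).symm

theorem AdjSupport.isMultiHom {p q : stdSimplex ℝ W} (h : AdjSupport G p q) :
    IsMultiHom (⊤ : SimpleGraph (Fin 2)) G fun v => {a | (![p, q] : Fin 2 → _) v a ≠ 0} := by
  refine ⟨fun v => stdSimplex.exists_ne_zero _, fun f hf u u' huu' => ?_⟩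
  have h0 : p (f 0) ≠ 0 := hf 0
  have h1 : q (f 1) ≠ 0 := hf 1
  fin_cases u <;> fin_cases u'
  · exact absurd rfl huu'
  · exact h _ _ h0 h1
  · exact (h _ _ h0 h1).symm
  · exact absurd rfl huu'

/-- The map to `Hom(K₂, G)` with given components. -/
def pairMap (p q : C(A, stdSimplex ℝ W)) (h : ∀ x, AdjSupport G (p x) (q x)) : C(A, homK2 G) where
  toFun x := ⟨![p x, q x], (h x).isMultiHom⟩
  continuous_toFun := by
    refine Continuous.subtype_mk (continuous_pi fun v => ?_) _
    fin_cases v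
    · exact p.continuous
    · exact q.continuous

theorem pairMap_homotopic_left {p p' q : C(A, stdSimplex ℝ W)}
    (h : ∀ x, AdjSupport G (p x) (q x)) (h' : ∀ x, AdjSupport G (p' x) (q x)) :
    (pairMap p q h).Homotopic (pairMap p' q h') :=
  ⟨{ toContinuousMap := pairMap (A := I × A)
      ⟨fun x => stdSimplex.mix x.1 (p x.2) (p' x.2), stdSimplex.continuous_mix.comp
        (f := fun x : I × A => (x.1, p x.2, p' x.2)) (by fun_prop)⟩
      (q.comp ContinuousMap.snd) fun x => (h x.2).mix_left (h' x.2) x.1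
     map_zero_left := fun x => Subtype.ext (congrArg (![·, q x]) (stdSimplex.mix_zero _ _))
     map_one_left := fun x => Subtype.ext (congrArg (![·, q x]) (stdSimplex.mix_one _ _)) }⟩

theorem pairMap_homotopic_right {p q q' : C(A, stdSimplex ℝ W)}
    (h : ∀ x, AdjSupport G (p x) (q x)) (h' : ∀ x, AdjSupport G (p x) (q' x)) :
    (pairMap p q h).Homotopic (pairMap p q' h') :=
  ⟨{ toContinuousMap := pairMap (A := I × A) (p.comp ContinuousMap.snd)
      ⟨fun x => stdSimplex.mix x.1 (q x.2) (q' x.2), stdSimplex.continuous_mix.comp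
        (f := fun x : I × A => (x.1, q x.2, q' x.2)) (by fun_prop)⟩
      fun x => (h x.2).mix_right (h' x.2) x.1
     map_zero_left := fun x => Subtype.ext (congrArg (![p x, ·]) (stdSimplex.mix_zero _ _))
     map_one_left := fun x => Subtype.ext (congrArg (![p x, ·]) (stdSimplex.mix_one _ _)) }⟩

variable {r : ℕ} {hr : 1 ≤ r}

/-- The component of a point of `Hom(C_{2r+1}, G)` at the vertex `i` modulo `2r + 1` of the cycle.
-/
def evalMap (r : ℕ) (hr : 1 ≤ r) (G : SimpleGraph W) (i : ℕ) :
    C(homOddCycle r hr G, stdSimplex ℝ W) :=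
  ⟨fun x => x.1 (Fin.ofNat (2 * r + 1) i), HomComplex.continuous_apply _ _ _⟩

theorem adjSupport_evalMap (i : ℕ) (x : homOddCycle r hr G) :
    AdjSupport G (evalMap r hr G i x) (evalMap r hr G (i + 1) x) := by
  intro a b ha hb
  refine x.2.adj (u := Fin.ofNat (2 * r + 1) i) (v := Fin.ofNat (2 * r + 1) (i + 1)) ?_ ha hb
  have h1 : Fin.ofNat (2 * r + 1) (i + 1) = Fin.ofNat (2 * r + 1) i + 1 := by
    apply Fin.ext
    simp [Fin.val_add, Fin.ofNat]
  have h2 : (1 : Fin (2 * r + 1)) ≠ 0 := by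
    intro h
    have := congrArg Fin.val h
    rw [Fin.val_one', Fin.val_zero, Nat.mod_eq_of_lt (by omega)] at this
    omega
  rw [SimpleGraph.cycleGraph_eq_circulantGraph, SimpleGraph.circulantGraph_adj, h1]
  refine ⟨fun h => h2 ?_, Or.inr ?_⟩
  · simpa using h.symm
  · simp

theorem evalMap_period (i : ℕ) : evalMap r hr G (i + (2 * r + 1)) = evalMap r hr G i := by
  ext1 x
  refine congrArg x.1 (Fin.ext ?_)
  simp [Fin.ofNat]

theorem evalMap_τ {i j : ℕ} (hij : i + j = 2 * r) (x : homOddCycle r hr G) :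
    evalMap r hr G i ((homOddCycle r hr G).τ x) = evalMap r hr G j x := by
  refine congrArg x.1 (Fin.ext ?_)
  change (Fin.rev _).val = _
  rw [Fin.val_rev]
  simp only [Fin.ofNat]
  rw [Nat.mod_eq_of_lt (by omega), Nat.mod_eq_of_lt (by omega)]
  omega

theorem adjSupport_evalMap_last (x : homOddCycle r hr G) :
    AdjSupport G (evalMap r hr G 0 x) (evalMap r hr G (2 * r) x) := by
  have h := (adjSupport_evalMap (2 * r) x).symm
  have e := evalMap_period (r := r) (hr := hr) (G := G) 0
  rw [zero_add] at e
  rwa [e] at h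

/-- The map `x ↦ (x₀, x_{2r})`, given by the edge that the reflection of the cycle flips. -/
def endsMap (r : ℕ) (hr : 1 ≤ r) (G : SimpleGraph W) : C(homOddCycle r hr G, homK2 G) :=
  pairMap (evalMap r hr G 0) (evalMap r hr G (2 * r)) adjSupport_evalMap_last

theorem endsMap_τ (x : homOddCycle r hr G) :
    endsMap r hr G ((homOddCycle r hr G).τ x) = (homK2 G).τ (endsMap r hr G x) := by
  apply Subtype.ext
  funext v
  fin_cases v
  · exact evalMap_τ (by omega) x
  · exact evalMap_τ (by omega) x

/-- The map `x ↦ (x₀, x_{2r})` can be moved to each pair of consecutive components, whose order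
depends on the parity of `i`. -/
theorem endsMap_homotopic (i : ℕ) :
    (endsMap r hr G).Homotopic
        (pairMap (evalMap r hr G i) (evalMap r hr G (i + 1)) (adjSupport_evalMap i)) ∨
      (endsMap r hr G).Homotopic
        (pairMap (evalMap r hr G (i + 1)) (evalMap r hr G i)
          fun x => (adjSupport_evalMap i x).symm) := by
  induction i with
  | zero => exact Or.inl (pairMap_homotopic_right _ _)
  | succ i ih =>
    rcases ih with h | h
    · exact Or.inr (h.trans (pairMap_homotopic_left _ _))
    · exact Or.inl (h.trans (pairMap_homotopic_right _ _))

/-- The map `x ↦ (x_{r-1} + x_{r+1}) / 2`, the midpoint of the components at the neighbours of the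
vertex that the reflection fixes. -/
noncomputable def midMap (r : ℕ) (hr : 1 ≤ r) (G : SimpleGraph W) :
    C(homOddCycle r hr G, stdSimplex ℝ W) :=
  ⟨fun x => stdSimplex.mix ⟨1 / 2, by norm_num, by norm_num⟩ (evalMap r hr G (r - 1) x)
    (evalMap r hr G (r + 1) x), stdSimplex.continuous_mix.comp
        (f := fun x => (_, evalMap r hr G (r - 1) x, evalMap r hr G (r + 1) x)) (by fun_prop)⟩

theorem midMap_τ (x : homOddCycle r hr G) :
    midMap r hr G ((homOddCycle r hr G).τ x) = midMap r hr G x := by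
  change stdSimplex.mix _ _ _ = stdSimplex.mix _ _ _
  rw [evalMap_τ (j := r + 1) (by omega), evalMap_τ (j := r - 1) (by omega)]
  apply Subtype.ext
  change (1 - (1 / 2 : ℝ)) • _ + (1 / 2 : ℝ) • _ = (1 - (1 / 2 : ℝ)) • _ + (1 / 2 : ℝ) • _
  rw [show (1 - (1 / 2 : ℝ)) = 1 / 2 by norm_num, add_comm]

theorem adjSupport_midMap (x : homOddCycle r hr G) :
    AdjSupport G (midMap r hr G x) (evalMap r hr G r x) := by
  have h := adjSupport_evalMap (r - 1) x
  rw [Nat.sub_add_cancel hr] at h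
  exact h.mix_left (adjSupport_evalMap r x).symm _

/-- The map `x ↦ (x₀, x_{2r})` is homotopic to a map that is invariant under the reflection. -/
theorem exists_homotopy (r : ℕ) (hr : 1 ≤ r) (G : SimpleGraph W) :
    ∃ P : C(homOddCycle r hr G, homK2 G), (∀ x, P ((homOddCycle r hr G).τ x) = P x) ∧
      P.Homotopic (endsMap r hr G) := by
  have hτ : ∀ x, evalMap r hr G r ((homOddCycle r hr G).τ x) = evalMap r hr G r x :=
    fun x => evalMap_τ (by omega) x
  have h := endsMap_homotopic (r := r) (hr := hr) (G := G) (r - 1)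
  simp only [Nat.sub_add_cancel hr] at h
  rcases h with h | h
  · refine ⟨pairMap (midMap r hr G) (evalMap r hr G r) adjSupport_midMap, fun x => ?_,
      (h.trans (pairMap_homotopic_left _ _)).symm⟩
    apply Subtype.ext
    change ![_, _] = ![_, _]
    rw [midMap_τ, hτ]
  · refine ⟨pairMap (evalMap r hr G r) (midMap r hr G) fun x => (adjSupport_midMap x).symm,
      fun x => ?_, (h.trans (pairMap_homotopic_right _ _)).symm⟩
    apply Subtype.ext
    change ![_, _] = ![_, _]
    rw [midMap_τ, hτ]

end Homotopy

/-! ### The inequalities between the indices -/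

section Index

open FreeZ2Space SingularZ2

variable {V : Type u} [Fintype V] {G : SimpleGraph V}

theorem wordCochain_mem_homOddCycle {r : ℕ} {hr : 1 ≤ r} {k : ℕ} {ε : homK2 G → ZMod 2}
    (hε : IsSign ε) (h : wordCochain (fun _ => ε) (k + 1) ∈ coboundaries (k + 1) (homK2 G).Orbits) :
    wordCochain (fun _ => ε ∘ endsMap r hr G) k ∈ coboundaries k (homOddCycle r hr G).Orbits := by
  obtain ⟨P, hP, ⟨H⟩⟩ := exists_homotopy r hr G
  exact wordCochain_mem_of_homotopy H hP endsMap_τ hε h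

theorem le_cohomologicalIndex_homK2 {k : ℕ} {ε : homK2 G → ZMod 2} (hε : IsSign ε)
    (h : wordCochain (fun _ => ε) k ∉ coboundaries k (homK2 G).Orbits) :
    (k : EReal) ≤ cohomologicalIndex (homK2 G) := by
  obtain ⟨f⟩ := nonempty_equivariantMap_homK2 G
  obtain ⟨γ, hγ⟩ := exists_pullback_ne_zero f hε h
  exact le_sSup (Or.inr ⟨k, rfl, f, γ, hγ⟩)

theorem cohomologicalIndex_homOddCycle_add_one_le (hG : ∃ a b, G.Adj a b) (r : ℕ) (hr : 1 ≤ r) :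
    cohomologicalIndex (homOddCycle r hr G) + 1 ≤ cohomologicalIndex (homK2 G) := by
  obtain ⟨ε, hε⟩ := exists_isSign (homK2 G)
  rw [← EReal.le_sub_iff_add_le (Or.inl (by decide)) (Or.inl (by decide))]
  refine sSup_le ?_
  rintro a (rfl | ⟨k, rfl, f, γ, hγ, h⟩)
  · rw [EReal.le_sub_iff_add_le (Or.inl (by decide)) (Or.inl (by decide))]
    -- if no `k` occurs for the odd cycle, it suffices that `Hom(K₂, G)` is nonempty
    have h0 : wordCochain (fun _ => ε) 0 ∉ coboundaries 0 (homK2 G).Orbits := by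
      classical
      obtain ⟨a, b, hab⟩ := hG
      let x : homK2 G := ⟨![stdSimplex.vertex a, stdSimplex.vertex b],
        AdjSupport.isMultiHom fun c d hc hd => by
          have hc' : c = a := by
            by_contra hne
            exact hc (Pi.single_eq_of_ne hne _)
          have hd' : d = b := by
            by_contra hne
            exact hd (Pi.single_eq_of_ne hne _)
          rwa [hc', hd']⟩
      intro h
      rw [mem_coboundaries_zero_iff] at h
      have h1 := congrFun h ((homK2 G).proj.comp (ContinuousMap.const _ x))
      rw [wordCochain_proj_comp (fun _ => hε)] at h1
      exact one_ne_zero h1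
    refine le_trans (le_of_eq ?_) (le_cohomologicalIndex_homK2 hε h0)
    rw [Nat.cast_zero]
    have e : ((-1 : ℝ) : EReal) + ((1 : ℝ) : EReal) = 0 := by rw [← EReal.coe_add]; norm_num
    exact e
  · rw [EReal.le_sub_iff_add_le (Or.inl (by decide)) (Or.inl (by decide))]
    have hε' : IsSign (ε ∘ endsMap r hr G) := fun x => by
      simp only [Function.comp_apply, endsMap_τ, hε (endsMap r hr G x)]
    have h1 := not_mem_of_pullback_ne_zero f γ hγ h hε'
    have h2 := le_cohomologicalIndex_homK2 (k := k + 1) hε fun h =>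
      h1 (wordCochain_mem_homOddCycle hε h)
    simpa using h2

theorem cohomologicalIndex_homK2_le (hG : ∃ a b, G.Adj a b) {n : ℕ} (hn : G.chromaticNumber = n) :
    cohomologicalIndex (homK2 G) ≤ (n : EReal) - 2 := by
  obtain ⟨ε, hε⟩ := exists_isSign (homK2 G)
  have hn2 : 2 ≤ n := by
    have := SimpleGraph.two_le_chromaticNumber_of_adj hG.choose_spec.choose_spec
    rw [hn] at this
    exact_mod_cast this
  have hcol : G.Colorable n := SimpleGraph.chromaticNumber_le_iff_colorable.1 hn.le
  have key : ∀ k : ℕ, k + 2 ≤ n → (k : EReal) ≤ (n : EReal) - 2 := by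
    intro k hk
    rw [EReal.le_sub_iff_add_le (Or.inl (by decide)) (Or.inl (by decide))]
    exact_mod_cast hk
  refine sSup_le ?_
  rintro a (rfl | ⟨k, rfl, f, γ, hγ, h⟩)
  · exact le_trans (by norm_num) (key 0 hn2)
  · refine key k ?_
    by_contra hlt
    have h1 := not_mem_of_pullback_ne_zero f γ hγ h hε
    refine h1 (wordCochain_homK2_mem ?_ (hcol.mono (by omega)) hε)
    omega

end Index

theorem mainTheorem2 {V : Type u} [Fintype V] (G : SimpleGraph V) (hG : ∃ a b, G.Adj a b)
    (r : ℕ) (hr : 1 ≤ r) :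
    cohomologicalIndex (homOddCycle r hr G) + 1 ≤ cohomologicalIndex (homK2 G) ∧
      cohomologicalIndex (homOddCycle r hr G) ≤ ((G.chromaticNumber : ℝ≥0∞) : EReal) - 3 := by
  have h1 := cohomologicalIndex_homOddCycle_add_one_le hG r hr
  refine ⟨h1, ?_⟩
  obtain ⟨n, hn⟩ := ENat.ne_top_iff_exists.1
    (SimpleGraph.chromaticNumber_ne_top_iff_exists.2 ⟨_, G.colorable_of_fintype⟩)
  have h2 := h1.trans (cohomologicalIndex_homK2_le hG hn.symm)
  rw [← hn]
  rw [ENat.toENNReal_coe, show (((n : ℕ) : ℝ≥0∞) : EReal) = (n : EReal) from rfl,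
    EReal.le_sub_iff_add_le (Or.inl (by decide)) (Or.inl (by decide))]
  rw [EReal.le_sub_iff_add_le (Or.inl (by decide)) (Or.inl (by decide)), add_assoc] at h2
  have e : (1 : ℝ) + 2 = 3 := by norm_num
  have e' : (1 : EReal) + 2 = 3 := by exact_mod_cast congrArg Real.toEReal e
  rwa [e'] at h2
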